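/- Let $N\ge 2$, let $\omega\subset\mathbb{R}^{N-1}$ be a bounded domain with smooth boundary, and let $\mathcal{C}_\omega=\omega\times(0,+\infty)\subset\mathbb{R}^N$ with lateral boundary $\partial\mathcal{C}_\omega^+=\partial\mathcal{C}_\omega\cap\{x_N>0\}$. Let $\varphi\in C^2(\overline{\omega})$ (that is, $\varphi$ is $C^2$ in $\omega$, continuous on $\overline\omega$, and its derivatives of order at most $2$ extend continuously to $\overline{\omega}$) with $\varphi>0$ on $\overline{\omega}$. Put $$\Gamma_\varphi=\{(x',x_N)\in\mathbb{R}^N: x'\in\omega,\ x_N=\varphi(x')\},\qquad \Omega_\varphi=\{(x',x_N)\in\mathbb{R}^N: x'\in\omega,\ 0<x_N<\varphi(x')\}.$$ Let $\nu$ be the unit normal to $\Gamma_\varphi$ exterior to $\Omega_\varphi$, extended by continuity to $\overline{\Gamma_\varphi}$. Let $H_{\Gamma_\varphi}$ be the mean curvature of $\Gamma_\varphi$ with respect to $\nu$, that is, the mean of the $N-1$ principal curvatures, with the sign for which spheres have positive mean curvature with respect to their exterior normal. Let $d\sigma$ be the $(N-1)$-dimensional surface measure (the $(N-1)$-dimensional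 Hausdorff measure, normalized to agree with Lebesgue measure on $\mathbb{R}^{N-1}$), and let $e_N=(0,\dots,0,1)$. Assume that $\Gamma_\varphi$ meets $\partial\mathcal{C}_\omega^+$ orthogonally: $\langle\nu(x),\nu_{\partial\mathcal{C}_\omega^+}(x)\rangle=0$ for every $x\in\overline{\Gamma_\varphi}\cap\partial\mathcal{C}_\omega^+$, where $\nu_{\partial\mathcal{C}_\omega^+}$ is the outer unit normal to $\mathcal{C}_\omega$ on $\partial\mathcal{C}_\omega^+$. Then both integrals below converge absolutely and $$\int_{\Gamma_\varphi} H_{\Gamma_\varphi}\,\langle x_N e_N,\nu\rangle\,d\sigma=\frac{1}{N-1}\int_\omega\frac{|\nabla\varphi|^2}{\sqrt{1+|\nabla\varphi|^2}}\,dx'.$$ -/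

import Mathlib

open Set Filter Topology MeasureTheory
open scoped RealInnerProductSpace

noncomputable section

namespace CylinderGraph

/-! ### Domains, boundaries and outer unit normals -/

section General

variable {E : Type*} [NormedAddCommGroup E] [InnerProductSpace ℝ E] [CompleteSpace E]

/-- `g` is a `C^k` local defining function of the set `D` near the boundary point `p`:
on some open neighbourhood `U` of `p` it is of class `C^k`, `D ∩ U = {x ∈ U | g x < 0}`, `g p = 0`
and `∇g(p) ≠ 0`. -/
def IsLocalDefiningFunction (k : ℕ∞) (D : Set E) (p : E) (g : E → ℝ) : Prop :=
  ∃ U : Set E, IsOpen U ∧ p ∈ U ∧ ContDiffOn ℝ k g U ∧ (∀ x ∈ U, x ∈ D ↔ g x < 0) ∧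
    g p = 0 ∧ gradient g p ≠ 0

/-- A smooth bounded domain: open, connected (hence nonempty), bounded, and near each point of its
boundary it lies on one side of a smooth hypersurface. -/
structure IsSmoothBoundedDomain (ω : Set E) : Prop where
  isOpen : IsOpen ω
  isConnected : IsConnected ω
  isBounded : Bornology.IsBounded ω
  smooth_boundary : ∀ p ∈ frontier ω, ∃ g : E → ℝ, IsLocalDefiningFunction (⊤ : ℕ∞) ω p g

/-- The class `C^k` up to the boundary of the open set `ω`: `f` is `C^k` in `ω`, continuous on
`closure ω`, and all its derivatives of order at most `k` extend continuously from `ω` to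
`closure ω`. -/
def ContDiffUpToBoundary (k : ℕ) (f : E → ℝ) (ω : Set E) : Prop :=
  ContDiffOn ℝ k f ω ∧ ContinuousOn f (closure ω) ∧
    ∀ j : ℕ, j ≤ k → ∃ T : E → ContinuousMultilinearMap ℝ (fun _ : Fin j => E) ℝ,
      ContinuousOn T (closure ω) ∧ EqOn T (iteratedFDeriv ℝ j f) ω

/-- `ν` is the outer unit normal to `D` at the `C^1` boundary point `p`: `ν = ∇g(p) / |∇g(p)|` for
a `C^1` local defining function `g` of `D` near `p`. -/
def IsOuterUnitNormal (D : Set E) (p ν : E) : Prop :=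
  ∃ g : E → ℝ, IsLocalDefiningFunction 1 D p g ∧ ν = ‖gradient g p‖⁻¹ • gradient g p

theorem IsOuterUnitNormal.norm_eq {D : Set E} {p ν : E} (h : IsOuterUnitNormal D p ν) :
    ‖ν‖ = 1 := by
  obtain ⟨g, ⟨U, -, -, -, -, -, hg⟩, rfl⟩ := h
  rw [norm_smul, norm_inv, norm_norm]
  exact inv_mul_cancel₀ (norm_ne_zero_iff.2 hg)

theorem IsOuterUnitNormal.exists_deriv {D : Set E} {p ν : E} (h : IsOuterUnitNormal D p ν) (v : E) :
    ∃ (f : ℝ → ℝ) (c : ℝ), 0 < c ∧ f 0 = 0 ∧ HasDerivAt f (c * ⟪ν, v⟫) 0 ∧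
      ∀ᶠ t in 𝓝 (0 : ℝ), p + t • v ∈ D ↔ f t < 0 := by
  obtain ⟨g, ⟨U, hU, hp, hC, hD, h0, hg⟩, rfl⟩ := h
  have hd : DifferentiableAt ℝ g p :=
    (hC.contDiffAt (hU.mem_nhds hp)).differentiableAt (by simp)
  have hl : HasDerivAt (fun t : ℝ => p + t • v) v 0 := by
    simpa using ((hasDerivAt_id (0 : ℝ)).smul_const v).const_add p
  have hgr : HasFDerivAt g (InnerProductSpace.toDual ℝ E (gradient g p)) (p + (0 : ℝ) • v) := by
    simpa using hd.hasGradientAt.hasFDerivAt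
  refine ⟨fun t => g (p + t • v), ‖gradient g p‖, norm_pos_iff.2 hg, by simpa using h0, ?_, ?_⟩
  · have := hgr.comp_hasDerivAt (0 : ℝ) hl
    rw [InnerProductSpace.toDual_apply_apply] at this
    rw [inner_smul_left, ← mul_assoc]
    have hc : ‖gradient g p‖ * (starRingEnd ℝ) ‖gradient g p‖⁻¹ = 1 :=
      mul_inv_cancel₀ (norm_ne_zero_iff.2 hg)
    rw [hc, one_mul]
    exact this
  · have hc : Tendsto (fun t : ℝ => p + t • v) (𝓝 0) (𝓝 p) := by
      simpa using hl.continuousAt.tendsto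
    filter_upwards [hc (hU.mem_nhds hp)] with t ht using hD _ ht

/-- The outer unit normal is unique. -/
theorem IsOuterUnitNormal.eq {D : Set E} {p ν μ : E} (h : IsOuterUnitNormal D p ν)
    (h' : IsOuterUnitNormal D p μ) : ν = μ := by
  by_contra hne
  have hν := h.norm_eq
  have hμ := h'.norm_eq
  have hlt : ⟪ν, μ⟫ < 1 := (inner_lt_one_iff_real_of_norm_eq_one hν hμ).2 hne
  obtain ⟨f, c, hc, f0, hf, hfD⟩ := h.exists_deriv (μ - ν)
  obtain ⟨k, d, hd, k0, hk, hkD⟩ := h'.exists_deriv (μ - ν)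
  have e1 : c * ⟪ν, μ - ν⟫ < 0 := by
    rw [inner_sub_right, real_inner_self_eq_norm_sq, hν]
    exact mul_neg_of_pos_of_neg hc (by linarith)
  have e2 : 0 < d * ⟪μ, μ - ν⟫ := by
    rw [inner_sub_right, real_inner_self_eq_norm_sq, hμ, real_inner_comm]
    exact mul_pos hd (by linarith)
  have s1 := (hasDerivAt_iff_tendsto_slope.1 hf).eventually (gt_mem_nhds e1)
  have s2 := (hasDerivAt_iff_tendsto_slope.1 hk).eventually (lt_mem_nhds e2)
  have hle : 𝓝[>] (0 : ℝ) ≤ 𝓝[≠] 0 := nhdsWithin_mono _ fun x hx => ne_of_gt hx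
  have hle' : 𝓝[>] (0 : ℝ) ≤ 𝓝 0 := nhdsWithin_le_nhds
  obtain ⟨t, ⟨⟨⟨⟨a1, a2⟩, a3⟩, a4⟩, a5⟩⟩ := ((((s1.filter_mono hle).and (s2.filter_mono hle)).and
    (hfD.filter_mono hle')).and (hkD.filter_mono hle')).and self_mem_nhdsWithin |>.exists
  have ht : (0 : ℝ) < t := a5
  simp only [slope_def_field, f0, k0, sub_zero] at a1 a2
  have b1 : f t < 0 := by
    by_contra hn
    exact absurd a1 (not_lt.2 (div_nonneg (not_lt.1 hn) ht.le))
  have b2 : 0 < k t := by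
    by_contra hn
    exact absurd a2 (not_lt.2 (div_nonpos_of_nonpos_of_nonneg (not_lt.1 hn) ht.le))
  exact absurd (a4.1 (a3.2 b1)) (not_lt.2 b2.le)

/-- The outer unit normal to `D` at `p`. It is a junk value if `p` is not a `C^1` boundary point;
otherwise it is the only vector as in `IsOuterUnitNormal`. -/
def outerUnitNormal (D : Set E) (p : E) : E :=
  Classical.epsilon (IsOuterUnitNormal D p)

theorem outerUnitNormal_eq {D : Set E} {p ν : E} (h : IsOuterUnitNormal D p ν) :
    outerUnitNormal D p = ν :=
  (Classical.epsilon_spec (p := IsOuterUnitNormal D p) ⟨ν, h⟩).eq h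

end General

/-! ### Mean curvature of a parametrized hypersurface -/

/-- The partial derivative `∂ᵢ F` of a map defined on `ℝⁿ`. -/
def partialDeriv {n : ℕ} {V : Type*} [NormedAddCommGroup V] [NormedSpace ℝ V]
    (i : Fin n) (F : EuclideanSpace ℝ (Fin n) → V) (y : EuclideanSpace ℝ (Fin n)) : V :=
  fderiv ℝ F y (EuclideanSpace.single i 1)

variable {n : ℕ}

/-- First fundamental form `⟨∂ᵢF, ∂ⱼF⟩` of the parametrized hypersurface `F` at parameter `y`. -/
def firstFundamentalForm
    (F : EuclideanSpace ℝ (Fin n) → EuclideanSpace ℝ (Fin (n + 1)))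
    (y : EuclideanSpace ℝ (Fin n)) : Matrix (Fin n) (Fin n) ℝ :=
  Matrix.of fun i j => ⟪partialDeriv i F y, partialDeriv j F y⟫

/-- Second fundamental form `-⟨∂ᵢ∂ⱼF, ν⟩` of the parametrized hypersurface `F` at parameter `y`,
with respect to the unit normal `ν` at `F y`. With this sign it equals `⟨∂ᵢν, ∂ⱼF⟩`, and it is
positive definite for a sphere and its exterior normal. -/
def secondFundamentalForm
    (F : EuclideanSpace ℝ (Fin n) → EuclideanSpace ℝ (Fin (n + 1)))
    (ν : EuclideanSpace ℝ (Fin (n + 1))) (y : EuclideanSpace ℝ (Fin n)) :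
    Matrix (Fin n) (Fin n) ℝ :=
  Matrix.of fun i j => -⟪partialDeriv i (partialDeriv j F) y, ν⟫

/-- Mean curvature: the mean of the principal curvatures, that is, `1/n` times the trace of the
second fundamental form with respect to the first. -/
def meanCurvature
    (F : EuclideanSpace ℝ (Fin n) → EuclideanSpace ℝ (Fin (n + 1)))
    (ν : EuclideanSpace ℝ (Fin (n + 1))) (y : EuclideanSpace ℝ (Fin n)) : ℝ :=
  (1 / (n : ℝ)) * ((firstFundamentalForm F y)⁻¹ * secondFundamentalForm F ν y).trace

/-! ### Graphs in the cylinder; here `N = n + 1` -/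

/-- The horizontal part `x'` of `x = (x', x_N)`. -/
def base (x : EuclideanSpace ℝ (Fin (n + 1))) : EuclideanSpace ℝ (Fin n) :=
  WithLp.toLp 2 fun i => x i.castSucc

/-- The last coordinate `x_N` of `x = (x', x_N)`. -/
def height (x : EuclideanSpace ℝ (Fin (n + 1))) : ℝ := x (Fin.last n)

/-- The vector `e_N = (0, …, 0, 1)`. -/
def eLast : EuclideanSpace ℝ (Fin (n + 1)) := EuclideanSpace.single (Fin.last n) 1

/-- The map `x' ↦ (x', φ x')`. -/
def graphMap (φ : EuclideanSpace ℝ (Fin n) → ℝ) (y : EuclideanSpace ℝ (Fin n)) :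
    EuclideanSpace ℝ (Fin (n + 1)) :=
  WithLp.toLp 2 (Fin.snoc (α := fun _ => ℝ) (fun i => y i) (φ y))

/-- The half-cylinder `ω × (0, ∞)`. -/
def cylinder (ω : Set (EuclideanSpace ℝ (Fin n))) : Set (EuclideanSpace ℝ (Fin (n + 1))) :=
  {x | base x ∈ ω ∧ 0 < height x}

/-- The lateral part of the boundary of the half-cylinder. -/
def lateralBoundary (ω : Set (EuclideanSpace ℝ (Fin n))) :
    Set (EuclideanSpace ℝ (Fin (n + 1))) :=
  frontier (cylinder ω) ∩ {x | 0 < height x}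

/-- The cartesian graph `Γ_φ` over `ω`. -/
def graph (ω : Set (EuclideanSpace ℝ (Fin n))) (φ : EuclideanSpace ℝ (Fin n) → ℝ) :
    Set (EuclideanSpace ℝ (Fin (n + 1))) :=
  {x | base x ∈ ω ∧ height x = φ (base x)}

/-- The part `Ω_φ` of the half-cylinder below the graph. -/
def subgraph (ω : Set (EuclideanSpace ℝ (Fin n))) (φ : EuclideanSpace ℝ (Fin n) → ℝ) :
    Set (EuclideanSpace ℝ (Fin (n + 1))) :=
  {x | x ∈ cylinder ω ∧ height x < φ (base x)}

/-- The unit normal field of `Γ_φ` exterior to `Ω_φ`, extended by continuity to the closure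
of `Γ_φ`. -/
def graphNormal (ω : Set (EuclideanSpace ℝ (Fin n))) (φ : EuclideanSpace ℝ (Fin n) → ℝ) :
    EuclideanSpace ℝ (Fin (n + 1)) → EuclideanSpace ℝ (Fin (n + 1)) :=
  extendFrom (graph ω φ) (outerUnitNormal (subgraph ω φ))

/-- The mean curvature of `Γ_φ` at its point `x`, with respect to the exterior unit normal. -/
def graphMeanCurvature (ω : Set (EuclideanSpace ℝ (Fin n))) (φ : EuclideanSpace ℝ (Fin n) → ℝ)
    (x : EuclideanSpace ℝ (Fin (n + 1))) : ℝ :=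
  meanCurvature (graphMap φ) (graphNormal ω φ x) (base x)

/-- `Γ_φ` meets the lateral boundary of the cylinder orthogonally: at the common points of that
boundary and of the closure of `Γ_φ` the two normals are orthogonal. -/
def MeetsOrthogonally (ω : Set (EuclideanSpace ℝ (Fin n))) (φ : EuclideanSpace ℝ (Fin n) → ℝ) :
    Prop :=
  ∀ x ∈ closure (graph ω φ) ∩ lateralBoundary ω,
    ⟪graphNormal ω φ x, outerUnitNormal (cylinder ω) x⟫ = 0

end CylinderGraph

end

/-!
Write `W = √(1 + |∇φ|²)`. The mean curvature of the graph is `H = -(1/n) div (∇φ / W)`, its normal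
has vertical component `1 / W`, and its area element is `W dx'`, so the left-hand side is
`-(1/n) ∫ φ div (∇φ / W)` over `ω`. Orthogonality of the graph and the cylinder says that `∇φ` is
tangential to `∂ω`; hence integrating by parts leaves no boundary term and gives
`(1/n) ∫ ⟨∇φ, ∇φ / W⟩`.

The divergence theorem is needed only for fields `V` tangential to `∂ω`, so no surface measure on
`∂ω` enters. Where `ω` is `{g < 0}`, multiply `V` by a cutoff that is a function of `k g`: the error
term is an integral of `⟨∇g, V⟩` over a layer of width of order `1/k` with weight `k`, and it tends
to zero because `⟨∇g, V⟩` does so at the boundary.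
-/

noncomputable section

namespace CylinderGraph

/-! ### The divergence theorem for tangential vector fields -/

section Divergence

variable {E : Type*} [NormedAddCommGroup E] [NormedSpace ℝ E]

/-- The divergence of a vector field on a normed space: the trace of its derivative. -/
def divergence (V : E → E) (y : E) : ℝ :=
  LinearMap.trace ℝ E (fderiv ℝ V y)

theorem divergence_eq_zero_of_notMem_tsupport {V : E → E} {y : E} (hy : y ∉ tsupport V) :
    divergence V y = 0 := by
  rw [divergence, fderiv_of_notMem_tsupport ℝ hy, ContinuousLinearMap.toLinearMap_zero, map_zero]

theorem support_divergence_subset (V : E → E) : Function.support (divergence V) ⊆ tsupport V :=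
  fun _ hx => by_contra fun h => hx (divergence_eq_zero_of_notMem_tsupport h)

theorem divergence_congr {V W : E → E} {y : E} (h : V =ᶠ[𝓝 y] W) :
    divergence V y = divergence W y := by
  rw [divergence, h.fderiv_eq, divergence]

variable [FiniteDimensional ℝ E]

theorem divergence_smul {a : E → ℝ} {V : E → E} {y : E}
    (ha : DifferentiableAt ℝ a y) (hV : DifferentiableAt ℝ V y) :
    divergence (fun x => a x • V x) y = a y * divergence V y + fderiv ℝ a y (V y) := by
  have h : LinearMap.trace ℝ E ((fderiv ℝ a y).smulRight (V y)) = fderiv ℝ a y (V y) :=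
    LinearMap.trace_smulRight (fderiv ℝ a y).toLinearMap (V y)
  simp only [divergence, fderiv_fun_smul ha hV, ContinuousLinearMap.toLinearMap_add,
    ContinuousLinearMap.toLinearMap_smul, map_add, map_smul, smul_eq_mul, h]

theorem continuous_trace : Continuous fun L : E →L[ℝ] E => LinearMap.trace ℝ E L :=
  (LinearMap.trace ℝ E ∘ₗ ContinuousLinearMap.coeLM ℝ).continuous_of_finiteDimensional

theorem continuous_divergence {V : E → E} (hV : ContDiff ℝ 1 V) : Continuous (divergence V) :=
  continuous_trace.comp (hV.continuous_fderiv one_ne_zero)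

theorem divergence_eq_sum {ι : Type*} [Fintype ι] (b : Module.Basis ι ℝ E) {V : E → E} {y : E}
    (hV : DifferentiableAt ℝ V y) :
    divergence V y = ∑ i, fderiv ℝ (fun x => b.coord i (V x)) y (b i) := by
  classical
  have h (i : ι) : fderiv ℝ (fun x => b.coord i (V x)) y =
      (b.coord i).toContinuousLinearMap ∘L fderiv ℝ V y :=
    ((b.coord i).toContinuousLinearMap.hasFDerivAt.comp y hV.hasFDerivAt).fderiv
  simp_rw [h, divergence, LinearMap.trace_eq_matrix_trace ℝ b]
  simp [Matrix.trace, LinearMap.toMatrix_apply]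

variable [MeasurableSpace E] [BorelSpace E] (μ : Measure E) [μ.IsAddHaarMeasure]

theorem integral_fderiv_apply_eq_zero {f : E → ℝ} (hf : ContDiff ℝ 1 f)
    (hc : HasCompactSupport f) (v : E) : ∫ x, fderiv ℝ f x v ∂μ = 0 := by
  have hi : Integrable (fun x => fderiv ℝ f x v) μ :=
    ((hf.continuous_fderiv one_ne_zero).clm_apply continuous_const).integrable_of_hasCompactSupport
      (hc.fderiv_apply ℝ v)
  simpa using integral_mul_fderiv_eq_neg_fderiv_mul_of_integrable (μ := μ)
    (f := fun _ : E => (1 : ℝ)) (g := f) (v := v)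
    (by simp) (by simpa using hi)
    (by simpa using hf.continuous.integrable_of_hasCompactSupport hc)
    (fun x _ => differentiableAt_const _) (fun x _ => hf.differentiable one_ne_zero x)

theorem integrable_divergence_of_hasCompactSupport {V : E → E} (hV : ContDiff ℝ 1 V)
    (hc : HasCompactSupport V) : Integrable (divergence V) μ :=
  (continuous_divergence hV).integrable_of_hasCompactSupport
    (hc.mono' (support_divergence_subset V))

theorem integral_divergence_eq_zero_of_hasCompactSupport {V : E → E} (hV : ContDiff ℝ 1 V)
    (hc : HasCompactSupport V) : ∫ x, divergence V x ∂μ = 0 := by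
  let b := Module.finBasis ℝ E
  have hb (i) : ContDiff ℝ 1 fun x => b.coord i (V x) :=
    (b.coord i).toContinuousLinearMap.contDiff.comp hV
  have hbc (i) : HasCompactSupport fun x => b.coord i (V x) :=
    hc.comp_left (g := b.coord i) (map_zero _)
  simp_rw [divergence_eq_sum b (hV.differentiable one_ne_zero _)]
  rw [integral_finsetSum _ fun i _ => ((((hb i).continuous_fderiv one_ne_zero).clm_apply
    continuous_const).integrable_of_hasCompactSupport ((hbc i).fderiv_apply ℝ _))]
  exact Finset.sum_eq_zero fun i _ => integral_fderiv_apply_eq_zero μ (hb i) (hbc i) _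

end Divergence

section InteriorCutoff

variable {E F : Type*} {g : E → ℝ} {U : Set E} {x : E}

/-- The part of `U` on the negative side of the hypersurface `g = 0`. -/
def negativeSide (U : Set E) (g : E → ℝ) : Set E :=
  {x ∈ U | g x < 0}

/-- A smooth function of `g` that vanishes for `-1 ≤ k * g x` and equals `1` for `k * g x ≤ -2`:
as `k → ∞`, a cutoff that exhausts `negativeSide U g`. -/
def interiorCutoff (g : E → ℝ) (k : ℕ) (x : E) : ℝ :=
  Real.smoothTransition (-(k * g x) - 1)

/-- The density with which `interiorCutoff g k` decreases in `g`. It concentrates in the layer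
`-2 ≤ k * g x ≤ -1`, where it approximates the surface measure of `g = 0`. -/
def layerDensity (g : E → ℝ) (k : ℕ) (x : E) : ℝ :=
  k * deriv Real.smoothTransition (-(k * g x) - 1)

theorem interiorCutoff_nonneg (g : E → ℝ) (k : ℕ) (x : E) : 0 ≤ interiorCutoff g k x :=
  Real.smoothTransition.nonneg _

theorem interiorCutoff_le_one (g : E → ℝ) (k : ℕ) (x : E) : interiorCutoff g k x ≤ 1 :=
  Real.smoothTransition.le_one _

theorem tendsto_interiorCutoff (hx : g x < 0) :
    Tendsto (fun k => interiorCutoff g k x) atTop (𝓝 1) := by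
  have hk : ∀ᶠ k : ℕ in atTop, 2 ≤ (k : ℝ) * -g x :=
    (tendsto_natCast_atTop_atTop.atTop_mul_const (neg_pos.2 hx)).eventually_ge_atTop 2
  refine tendsto_const_nhds.congr' ?_
  filter_upwards [hk] with k hk
  exact (Real.smoothTransition.one_of_one_le (by linarith)).symm

theorem layerDensity_nonneg (g : E → ℝ) (k : ℕ) (x : E) : 0 ≤ layerDensity g k x :=
  mul_nonneg k.cast_nonneg Real.smoothTransition.monotone.deriv_nonneg

theorem layerDensity_eq_zero {k : ℕ} (h : 2 < -(k * g x)) : layerDensity g k x = 0 := by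
  have : Real.smoothTransition =ᶠ[𝓝 (-(k * g x) - 1)] fun _ => (1 : ℝ) := by
    filter_upwards [lt_mem_nhds (show (1 : ℝ) < _ by linarith)] with s hs
    exact Real.smoothTransition.one_of_one_le hs.le
  rw [layerDensity, this.deriv_eq, deriv_const, mul_zero]

theorem isOpen_negativeSide [TopologicalSpace E] (hU : IsOpen U)
    (hg : ContinuousOn g U) : IsOpen (negativeSide U g) :=
  hg.isOpen_inter_preimage hU isOpen_Iio

theorem interiorCutoff_eventuallyEq_zero [TopologicalSpace E] (hg : ContinuousAt g x)
    (hx : 0 ≤ g x) (k : ℕ) : interiorCutoff g k =ᶠ[𝓝 x] 0 := by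
  have hcont : ContinuousAt (fun y => -(k * g y) - 1) x := by fun_prop
  have hneg : -((k : ℝ) * g x) - 1 < 0 := by linarith [mul_nonneg k.cast_nonneg hx]
  filter_upwards [hcont.eventually_lt_const hneg] with y hy
  exact Real.smoothTransition.zero_of_nonpos hy.le

theorem tsupport_interiorCutoff_smul_subset [TopologicalSpace E] [AddCommGroup F] [Module ℝ F]
    (hU : IsOpen U) (hg : ContinuousOn g U) {W : E → F} (hW : tsupport W ⊆ U) (k : ℕ) :
    tsupport (fun x => interiorCutoff g k x • W x) ⊆ negativeSide U g := by
  intro x hx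
  have hxU : x ∈ U := hW (tsupport_smul_subset_right _ W hx)
  refine ⟨hxU, not_le.1 fun hgx => notMem_tsupport_iff_eventuallyEq.2 ?_ hx⟩
  filter_upwards [interiorCutoff_eventuallyEq_zero (hg.continuousAt (hU.mem_nhds hxU)) hgx k]
    with y hy
  simp [hy]

end InteriorCutoff

section TangentialField

variable {E : Type*} [NormedAddCommGroup E] [NormedSpace ℝ E] {U : Set E} {g : E → ℝ}

theorem hasFDerivAt_interiorCutoff {g' : E →L[ℝ] ℝ} {x : E} (hg : HasFDerivAt g g' x) (k : ℕ) :
    HasFDerivAt (interiorCutoff g k) (-layerDensity g k x • g') x := by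
  have h₁ : HasFDerivAt (fun y => -(k * g y) - 1) (-((k : ℝ) • g')) x :=
    (hg.const_mul (k : ℝ)).neg.sub_const 1
  have h₂ : HasDerivAt Real.smoothTransition (deriv Real.smoothTransition (-(k * g x) - 1))
      (-(k * g x) - 1) :=
    ((Real.smoothTransition.contDiffAt (n := 1)).differentiableAt one_ne_zero).hasDerivAt
  refine (h₂.comp_hasFDerivAt x h₁).congr_fderiv ?_
  rw [layerDensity, smul_neg, smul_smul, mul_comm]
  exact (neg_smul _ _).symm

theorem contDiffOn_interiorCutoff (hg : ContDiffOn ℝ 1 g U) (k : ℕ) :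
    ContDiffOn ℝ 1 (interiorCutoff g k) U :=
  Real.smoothTransition.contDiff.comp_contDiffOn (by fun_prop)

theorem contDiff_of_forall_mem_tsupport {F : Type*} [NormedAddCommGroup F] [NormedSpace ℝ F]
    {k : WithTop ℕ∞} {f : E → F} (hf : ∀ x ∈ tsupport f, ContDiffAt ℝ k f x) :
    ContDiff ℝ k f := by
  refine contDiff_iff_contDiffAt.2 fun x => ?_
  by_cases hx : x ∈ tsupport f
  · exact hf x hx
  · exact contDiffAt_const.congr_of_eventuallyEq (notMem_tsupport_iff_eventuallyEq.1 hx)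

theorem contDiff_interiorCutoff_smul (hU : IsOpen U) (hg : ContDiffOn ℝ 1 g U) {W : E → E}
    (hW : ContDiffOn ℝ 1 W (negativeSide U g)) (hWU : tsupport W ⊆ U) (k : ℕ) :
    ContDiff ℝ 1 fun x => interiorCutoff g k x • W x := by
  refine contDiff_of_forall_mem_tsupport fun x hx => ?_
  have hxD := tsupport_interiorCutoff_smul_subset hU hg.continuousOn hWU k hx
  exact ((contDiffOn_interiorCutoff hg k).contDiffAt (hU.mem_nhds hxD.1)).smul
    (hW.contDiffAt ((isOpen_negativeSide hU hg.continuousOn).mem_nhds hxD))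

theorem integrableOn_interiorCutoff_mul [MeasurableSpace E] [BorelSpace E]
    {μ : Measure E} (hU : IsOpen U) (hg : ContDiffOn ℝ 1 g U) {f : E → ℝ}
    (hf : IntegrableOn f (negativeSide U g) μ) (k : ℕ) :
    IntegrableOn (fun x => interiorCutoff g k x * f x) (negativeSide U g) μ := by
  refine Integrable.bdd_mul (c := 1) hf (((contDiffOn_interiorCutoff hg k).continuousOn.mono
    (sep_subset _ _)).aestronglyMeasurable (isOpen_negativeSide hU hg.continuousOn).measurableSet)
    (Eventually.of_forall fun x => ?_)
  rw [Real.norm_of_nonneg (interiorCutoff_nonneg g k x)]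
  exact interiorCutoff_le_one g k x

theorem tendsto_setIntegral_interiorCutoff_mul [MeasurableSpace E] [BorelSpace E]
    {μ : Measure E} (hU : IsOpen U) (hg : ContDiffOn ℝ 1 g U)
    {f : E → ℝ} (hf : IntegrableOn f (negativeSide U g) μ) :
    Tendsto (fun k => ∫ x in negativeSide U g, interiorCutoff g k x * f x ∂μ) atTop
      (𝓝 (∫ x in negativeSide U g, f x ∂μ)) := by
  refine tendsto_integral_of_dominated_convergence (fun x => |f x|)
    (fun k => (integrableOn_interiorCutoff_mul hU hg hf k).aestronglyMeasurable) hf.abs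
    (fun k => Eventually.of_forall fun x => ?_)
    (ae_restrict_of_forall_mem (isOpen_negativeSide hU hg.continuousOn).measurableSet
      fun x hx => ?_)
  · rw [norm_mul, Real.norm_of_nonneg (interiorCutoff_nonneg g k x)]
    exact mul_le_of_le_one_left (norm_nonneg _) (interiorCutoff_le_one g k x)
  · simpa using (tendsto_interiorCutoff hx.2).mul_const (f x)

theorem exists_forall_abs_fderiv_apply_le (hU : IsOpen U) (hg : ContDiffOn ℝ 1 g U)
    {e : E} (he : ∀ x ∈ U, 0 < fderiv ℝ g x e) {W : E → E}
    (hW : ContinuousOn W (closure (negativeSide U g))) (hWc : HasCompactSupport W)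
    (hWU : tsupport W ⊆ U) (htan : ∀ x ∈ U ∩ frontier (negativeSide U g), fderiv ℝ g x (W x) = 0)
    {δ : ℝ} (hδ : 0 < δ) :
    ∃ κ > 0, ∀ x ∈ negativeSide U g, -κ < g x → |fderiv ℝ g x (W x)| ≤ δ * fderiv ℝ g x e := by
  have hg' : ContinuousOn (fderiv ℝ g) U := hg.continuousOn_fderiv_of_isOpen hU le_rfl
  let K := tsupport W ∩ closure (negativeSide U g)
  have hK : IsCompact K := hWc.isCompact.inter_right isClosed_closure
  have hKU : K ⊆ U := inter_subset_left.trans hWU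
  let f x := |fderiv ℝ g x (W x)| - δ * fderiv ℝ g x e
  have hf : ContinuousOn f K :=
    (((hg'.mono hKU).clm_apply (hW.mono inter_subset_right)).abs).sub
      (continuousOn_const.mul ((hg'.mono hKU).clm_apply continuousOn_const))
  have hbad : IsCompact (K ∩ f ⁻¹' Ici 0) :=
    hK.of_isClosed_subset (hf.preimage_isClosed_of_isClosed hK.isClosed isClosed_Ici)
      inter_subset_left
  have hneg : ∀ x ∈ K ∩ f ⁻¹' Ici 0, 0 < -g x := by
    rintro x ⟨hxK, hfx : 0 ≤ f x⟩
    by_contra hgx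
    have hxD : x ∈ frontier (negativeSide U g) := by
      rw [(isOpen_negativeSide hU hg.continuousOn).frontier_eq]
      exact ⟨hxK.2, fun h => hgx (neg_pos.2 h.2)⟩
    have := mul_pos hδ (he x (hKU hxK))
    simp only [f, htan x ⟨hKU hxK, hxD⟩, abs_zero] at hfx
    linarith
  obtain ⟨κ, hκ, hκg⟩ :=
    hbad.exists_forall_le' (hg.continuousOn.neg.mono (inter_subset_left.trans hKU)) hneg
  refine ⟨κ, hκ, fun x hx hgx => not_lt.1 fun hlt => ?_⟩
  have hxW : x ∈ tsupport W := by
    by_contra h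
    rw [image_eq_zero_of_notMem_tsupport h, map_zero, abs_zero] at hlt
    exact hlt.not_gt (mul_pos hδ (he x hx.1))
  have : κ ≤ -g x := hκg x ⟨⟨hxW, subset_closure hx⟩, sub_nonneg.2 hlt.le⟩
  linarith

theorem eventually_norm_layerDensity_mul_le (hU : IsOpen U) (hg : ContDiffOn ℝ 1 g U)
    {e : E} (he : ∀ x ∈ U, 0 < fderiv ℝ g x e) {W : E → E}
    (hW : ContinuousOn W (closure (negativeSide U g))) (hWc : HasCompactSupport W)
    (hWU : tsupport W ⊆ U) (htan : ∀ x ∈ U ∩ frontier (negativeSide U g), fderiv ℝ g x (W x) = 0)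
    {χ : E → ℝ} (hχ0 : ∀ x, 0 ≤ χ x) (hχ1 : EqOn χ 1 (tsupport W)) {δ : ℝ} (hδ : 0 < δ) :
    ∀ᶠ k : ℕ in atTop, ∀ x ∈ negativeSide U g, ‖layerDensity g k x * fderiv ℝ g x (W x)‖ ≤
      δ * (layerDensity g k x * (χ x * fderiv ℝ g x e)) := by
  obtain ⟨κ, hκ, hsmall⟩ := exists_forall_abs_fderiv_apply_le hU hg he hW hWc hWU htan hδ
  filter_upwards [(tendsto_natCast_atTop_atTop.atTop_mul_const hκ).eventually_gt_atTop 2]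
    with k hk x hx
  rw [norm_mul, Real.norm_of_nonneg (layerDensity_nonneg g k x), mul_left_comm, Real.norm_eq_abs]
  rcases le_or_gt (g x) (-κ) with hgx | hgx
  · have : (k : ℝ) * g x ≤ k * -κ := mul_le_mul_of_nonneg_left hgx k.cast_nonneg
    rw [layerDensity_eq_zero (by linarith), zero_mul, zero_mul]
  refine mul_le_mul_of_nonneg_left ?_ (layerDensity_nonneg g k x)
  by_cases hxW : x ∈ tsupport W
  · simpa [hχ1 hxW] using hsmall x hx hgx
  · rw [image_eq_zero_of_notMem_tsupport hxW, map_zero, abs_zero]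
    exact mul_nonneg hδ.le (mul_nonneg (hχ0 x) (he x hx.1).le)

variable [FiniteDimensional ℝ E]

theorem divergence_interiorCutoff_smul {W : E → E} {x : E} (hg : DifferentiableAt ℝ g x)
    (hW : DifferentiableAt ℝ W x) (k : ℕ) :
    divergence (fun y => interiorCutoff g k y • W y) x =
      interiorCutoff g k x * divergence W x - layerDensity g k x * fderiv ℝ g x (W x) := by
  have h := hasFDerivAt_interiorCutoff hg.hasFDerivAt k
  rw [divergence_smul h.differentiableAt hW, h.fderiv]
  simp [sub_eq_add_neg]

theorem exists_contDiff_hasCompactSupport_eqOn_one {K : Set E} (hK : IsCompact K) (hU : IsOpen U)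
    (hKU : K ⊆ U) :
    ∃ χ : E → ℝ, ContDiff ℝ 1 χ ∧ HasCompactSupport χ ∧ tsupport χ ⊆ U ∧ (∀ x, 0 ≤ χ x) ∧
      EqOn χ 1 K := by
  obtain ⟨V, hV, hKV, hVU, hVc⟩ := exists_open_between_and_isCompact_closure hK hU hKU
  obtain ⟨χ, h1, h0, hχ⟩ := exists_contMDiffMap_one_nhds_of_subset_interior (n := 1)
    (modelWithCornersSelf ℝ E) hK.isClosed
    (hKV.trans (interior_maximal subset_closure hV))
  have hsupp : tsupport χ ⊆ closure V :=
    closure_minimal (fun x hx => by_contra fun h => hx (h0 x h)) isClosed_closure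
  exact ⟨χ, χ.contMDiff.contDiff, hVc.of_isClosed_subset (isClosed_tsupport _) hsupp,
    hsupp.trans hVU, fun x => (hχ x).1, fun x hx => h1.self_of_nhdsSet x hx⟩

variable [MeasurableSpace E] [BorelSpace E] {μ : Measure E} [μ.IsAddHaarMeasure]

theorem integrableOn_layerDensity_mul_and_setIntegral_eq (hU : IsOpen U) (hg : ContDiffOn ℝ 1 g U)
    {W : E → E} (hW : ContDiffOn ℝ 1 W (negativeSide U g)) (hWc : HasCompactSupport W)
    (hWU : tsupport W ⊆ U) (hdiv : IntegrableOn (divergence W) (negativeSide U g) μ) (k : ℕ) :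
    IntegrableOn (fun x => layerDensity g k x * fderiv ℝ g x (W x)) (negativeSide U g) μ ∧
      ∫ x in negativeSide U g, layerDensity g k x * fderiv ℝ g x (W x) ∂μ =
        ∫ x in negativeSide U g, interiorCutoff g k x * divergence W x ∂μ := by
  have hD := isOpen_negativeSide hU hg.continuousOn
  let Z x := interiorCutoff g k x • W x
  have hZ : ContDiff ℝ 1 Z := contDiff_interiorCutoff_smul hU hg hW hWU k
  have hZc : HasCompactSupport Z := hWc.smul_left
  have hdivZ : IntegrableOn (divergence Z) (negativeSide U g) μ :=
    (integrable_divergence_of_hasCompactSupport μ hZ hZc).integrableOn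
  have hψ := integrableOn_interiorCutoff_mul hU hg hdiv k
  have hZ0 : ∫ x in negativeSide U g, divergence Z x ∂μ = 0 := by
    rw [setIntegral_eq_integral_of_forall_compl_eq_zero fun x hx =>
      divergence_eq_zero_of_notMem_tsupport fun h =>
        hx (tsupport_interiorCutoff_smul_subset hU hg.continuousOn hWU k h)]
    exact integral_divergence_eq_zero_of_hasCompactSupport μ hZ hZc
  have hEq : EqOn (fun x => interiorCutoff g k x * divergence W x - divergence Z x)
      (fun x => layerDensity g k x * fderiv ℝ g x (W x)) (negativeSide U g) := fun x hx => by
    simp only [Z, divergence_interiorCutoff_smul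
      ((hg.contDiffAt (hU.mem_nhds hx.1)).differentiableAt one_ne_zero)
      ((hW.contDiffAt (hD.mem_nhds hx)).differentiableAt one_ne_zero), sub_sub_cancel]
  refine ⟨IntegrableOn.congr_fun (hψ.sub hdivZ) hEq hD.measurableSet, ?_⟩
  rw [← setIntegral_congr_fun hD.measurableSet hEq, integral_sub hψ hdivZ, hZ0, sub_zero]

theorem integrableOn_layerDensity_mul_and_setIntegral_le (hU : IsOpen U) (hg : ContDiffOn ℝ 1 g U)
    {χ : E → ℝ} (hχ : ContDiff ℝ 1 χ) (hχc : HasCompactSupport χ) (hχU : tsupport χ ⊆ U)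
    (e : E) (k : ℕ) :
    IntegrableOn (fun x => layerDensity g k x * (χ x * fderiv ℝ g x e)) (negativeSide U g) μ ∧
      ∫ x in negativeSide U g, layerDensity g k x * (χ x * fderiv ℝ g x e) ∂μ ≤
        ∫ x in negativeSide U g, |fderiv ℝ χ x e| ∂μ := by
  have hdiv : divergence (fun x => χ x • e) = fun x => fderiv ℝ χ x e := by
    ext x
    rw [divergence_smul (hχ.differentiable one_ne_zero x) (differentiableAt_const e)]
    simp [divergence]
  have hχe : ContDiff ℝ 1 fun x => χ x • e := hχ.smul contDiff_const
  have hint : IntegrableOn (fun x => fderiv ℝ χ x e) (negativeSide U g) μ := by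
    rw [← hdiv]
    exact (integrable_divergence_of_hasCompactSupport μ hχe hχc.smul_right).integrableOn
  have h := integrableOn_layerDensity_mul_and_setIntegral_eq (μ := μ) hU hg
    hχe.contDiffOn hχc.smul_right
    ((tsupport_smul_subset_left χ _).trans hχU) (by rwa [hdiv]) k
  simp only [hdiv, map_smul, smul_eq_mul] at h
  refine ⟨h.1, h.2.trans_le ?_⟩
  refine integral_mono (integrableOn_interiorCutoff_mul hU hg hint k) hint.abs fun x => ?_
  calc interiorCutoff g k x * fderiv ℝ χ x e ≤ interiorCutoff g k x * |fderiv ℝ χ x e| :=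
        mul_le_mul_of_nonneg_left (le_abs_self _) (interiorCutoff_nonneg g k x)
    _ ≤ |fderiv ℝ χ x e| := mul_le_of_le_one_left (abs_nonneg _) (interiorCutoff_le_one g k x)

theorem setIntegral_negativeSide_divergence_eq_zero (hU : IsOpen U) (hg : ContDiffOn ℝ 1 g U)
    {e : E} (he : ∀ x ∈ U, 0 < fderiv ℝ g x e) {W : E → E}
    (hWcl : ContinuousOn W (closure (negativeSide U g)))
    (hW : ContDiffOn ℝ 1 W (negativeSide U g)) (hWc : HasCompactSupport W)
    (hWU : tsupport W ⊆ U) (hdiv : IntegrableOn (divergence W) (negativeSide U g) μ)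
    (htan : ∀ x ∈ U ∩ frontier (negativeSide U g), fderiv ℝ g x (W x) = 0) :
    ∫ x in negativeSide U g, divergence W x ∂μ = 0 := by
  have hDm := (isOpen_negativeSide hU hg.continuousOn).measurableSet
  obtain ⟨χ, hχ, hχc, hχU, hχ0, hχ1⟩ :=
    exists_contDiff_hasCompactSupport_eqOn_one hWc.isCompact hU hWU
  have hmass := integrableOn_layerDensity_mul_and_setIntegral_le (μ := μ) hU hg hχ hχc hχU e
  set C := ∫ x in negativeSide U g, |fderiv ℝ χ x e| ∂μ
  have hbound : ∀ δ > 0, |∫ x in negativeSide U g, divergence W x ∂μ| ≤ δ * C := by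
    intro δ hδ
    refine le_of_tendsto (tendsto_setIntegral_interiorCutoff_mul hU hg hdiv).abs ?_
    filter_upwards [eventually_norm_layerDensity_mul_le hU hg he hWcl hWc hWU htan hχ0 hχ1 hδ]
      with k hle
    rw [← (integrableOn_layerDensity_mul_and_setIntegral_eq hU hg hW hWc hWU hdiv k).2]
    calc |∫ x in negativeSide U g, layerDensity g k x * fderiv ℝ g x (W x) ∂μ|
        ≤ ∫ x in negativeSide U g, δ * (layerDensity g k x * (χ x * fderiv ℝ g x e)) ∂μ :=
          norm_integral_le_of_norm_le ((hmass k).1.const_mul δ)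
            (ae_restrict_of_forall_mem hDm hle)
      _ ≤ δ * C := by
          rw [integral_const_mul]
          exact mul_le_mul_of_nonneg_left (hmass k).2 hδ.le
  have hlim : Tendsto (fun δ => δ * C) (𝓝[>] 0) (𝓝 0) := by
    simpa using ((continuous_mul_const C).tendsto 0).mono_left nhdsWithin_le_nhds
  exact abs_nonpos_iff.1 (ge_of_tendsto hlim (eventually_mem_nhdsWithin.mono hbound))

end TangentialField

section DivergenceTheorem

variable {E : Type*} [NormedAddCommGroup E] [NormedSpace ℝ E]

/-- `V` is tangential to the frontier of `ω` near `p`: on an open neighbourhood of `p` the set `ω`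
is given by `g < 0` for a `C¹` function `g` with nonzero derivative at `p`, and the derivative of
`g` vanishes along `V` at the frontier points. -/
def IsTangentialNear (ω : Set E) (V : E → E) (p : E) : Prop :=
  ∃ (U : Set E) (g : E → ℝ), IsOpen U ∧ p ∈ U ∧ ContDiffOn ℝ 1 g U ∧ (∀ x ∈ U, x ∈ ω ↔ g x < 0) ∧
    fderiv ℝ g p ≠ 0 ∧ ∀ x ∈ U ∩ frontier ω, fderiv ℝ g x (V x) = 0

theorem IsTangentialNear.exists_fderiv_pos {ω : Set E} {V : E → E} {p : E}
    (h : IsTangentialNear ω V p) :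
    ∃ (U : Set E) (g : E → ℝ) (e : E), IsOpen U ∧ p ∈ U ∧ ContDiffOn ℝ 1 g U ∧
      ω ∩ U = negativeSide U g ∧ (∀ x ∈ U, 0 < fderiv ℝ g x e) ∧
      ∀ x ∈ U ∩ frontier ω, fderiv ℝ g x (V x) = 0 := by
  obtain ⟨U, g, hU, hpU, hg, hω, hgp, htan⟩ := h
  obtain ⟨e, he⟩ : ∃ e, 0 < fderiv ℝ g p e := by
    obtain ⟨v, hv⟩ := ContinuousLinearMap.exists_ne_zero hgp
    rcases hv.lt_or_gt with hv | hv
    exacts [⟨-v, by rwa [map_neg, neg_pos]⟩, ⟨v, hv⟩]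
  have hcont : ContinuousOn (fun x => fderiv ℝ g x e) U :=
    (hg.continuousOn_fderiv_of_isOpen hU le_rfl).clm_apply continuousOn_const
  refine ⟨U ∩ (fun x => fderiv ℝ g x e) ⁻¹' Ioi 0, g, e, hcont.isOpen_inter_preimage hU isOpen_Ioi,
    ⟨hpU, he⟩, hg.mono inter_subset_left, ?_, fun x hx => hx.2, fun x hx => htan x ⟨hx.1.1, hx.2⟩⟩
  ext x
  exact ⟨fun hx => ⟨hx.2, (hω x hx.2.1).1 hx.1⟩, fun hx => ⟨(hω x hx.1.1).2 hx.2, hx.1⟩⟩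

variable [FiniteDimensional ℝ E] {ω : Set E} {V : E → E}

theorem divergence_eq_sum_smul {ι : Type*} [Fintype ι] {ρ : ι → E → ℝ}
    (hρ : ∀ i, ContDiff ℝ 1 (ρ i)) (hω : IsOpen ω) (hV : ContDiffOn ℝ 1 V ω)
    (hsum : ∀ x ∈ ω, ∑ i, ρ i x = 1) {x : E} (hx : x ∈ ω) :
    divergence V x = ∑ i, divergence (fun y => ρ i y • V y) x := by
  have hVx : DifferentiableAt ℝ V x :=
    (hV.contDiffAt (hω.mem_nhds hx)).differentiableAt one_ne_zero
  have hsum' : ∑ i, fderiv ℝ (ρ i) x = 0 := by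
    have : (fun y => ∑ i, ρ i y) =ᶠ[𝓝 x] fun _ => (1 : ℝ) :=
      eventually_of_mem (hω.mem_nhds hx) hsum
    rw [← fderiv_fun_sum fun i _ => (hρ i).differentiable one_ne_zero x, this.fderiv_eq,
      fderiv_const_apply]
  simp_rw [divergence_smul ((hρ _).differentiable one_ne_zero x) hVx]
  rw [Finset.sum_add_distrib, ← Finset.sum_mul, hsum x hx, one_mul,
    ← _root_.sum_apply, hsum', zero_apply, add_zero]

variable [MeasurableSpace E] [BorelSpace E] {μ : Measure E}

theorem integrableOn_divergence_smul [μ.IsAddHaarMeasure] (hω : IsOpen ω)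
    (hωb : Bornology.IsBounded ω)
    (hVc : ContinuousOn V (closure ω)) (hV : ContDiffOn ℝ 1 V ω)
    (hdiv : IntegrableOn (divergence V) ω μ) {ρ : E → ℝ} (hρ : ContDiff ℝ 1 ρ) :
    IntegrableOn (divergence fun y => ρ y • V y) ω μ := by
  have hK : IsCompact (closure ω) := hωb.isCompact_closure
  have hρV : IntegrableOn (fun x => fderiv ℝ ρ x (V x)) ω μ :=
    (((hρ.continuous_fderiv one_ne_zero).continuousOn.clm_apply hVc).integrableOn_compact
      hK).mono_set subset_closure
  have hρdiv : IntegrableOn (fun x => ρ x * divergence V x) ω μ :=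
    hdiv.continuousOn_mul_of_subset hρ.continuous.continuousOn hK hω.measurableSet subset_closure
  refine IntegrableOn.congr_fun (hρdiv.add hρV) (fun x hx => ?_) hω.measurableSet
  exact (divergence_smul (hρ.differentiable one_ne_zero x)
    ((hV.contDiffAt (hω.mem_nhds hx)).differentiableAt one_ne_zero)).symm

theorem setIntegral_divergence_eq_zero_of_tsupport_subset [μ.IsAddHaarMeasure] (hω : IsOpen ω)
    (hV : ContDiffOn ℝ 1 V ω) (hVc : HasCompactSupport V) (hVω : tsupport V ⊆ ω) :
    ∫ x in ω, divergence V x ∂μ = 0 := by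
  rw [setIntegral_eq_integral_of_forall_compl_eq_zero fun x hx =>
    divergence_eq_zero_of_notMem_tsupport fun h => hx (hVω h)]
  exact integral_divergence_eq_zero_of_hasCompactSupport μ
    (contDiff_of_forall_mem_tsupport fun x hx => hV.contDiffAt (hω.mem_nhds (hVω hx))) hVc

theorem IsTangentialNear.exists_setIntegral_divergence_smul_eq_zero [μ.IsAddHaarMeasure]
    {p : E} (h : IsTangentialNear ω V p) (hω : IsOpen ω) (hωb : Bornology.IsBounded ω)
    (hVc : ContinuousOn V (closure ω)) (hV : ContDiffOn ℝ 1 V ω)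
    (hdiv : IntegrableOn (divergence V) ω μ) :
    ∃ U ∈ 𝓝 p, IsOpen U ∧ ∀ ρ : E → ℝ, ContDiff ℝ 1 ρ → HasCompactSupport ρ → tsupport ρ ⊆ U →
      ∫ x in ω, divergence (fun y => ρ y • V y) x ∂μ = 0 := by
  obtain ⟨U, g, e, hU, hpU, hg, hωU, he, htan⟩ := h.exists_fderiv_pos
  refine ⟨U, hU.mem_nhds hpU, hU, fun ρ hρ hρc hρU => ?_⟩
  have hρVU : tsupport (fun y => ρ y • V y) ⊆ U := (tsupport_smul_subset_left ρ V).trans hρU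
  have hsub : negativeSide U g ⊆ ω := hωU ▸ inter_subset_left
  rw [setIntegral_eq_of_subset_of_forall_sdiff_eq_zero hω.measurableSet hsub fun x hx =>
    divergence_eq_zero_of_notMem_tsupport fun hxρ => hx.2 (hωU ▸ ⟨hx.1, hρVU hxρ⟩)]
  refine setIntegral_negativeSide_divergence_eq_zero hU hg he
    (hρ.continuous.continuousOn.smul (hVc.mono (closure_mono hsub)))
    (hρ.contDiffOn.smul (hV.mono hsub)) hρc.smul_right hρVU
    ((integrableOn_divergence_smul hω hωb hVc hV hdiv hρ).mono_set hsub) fun x hx => ?_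
  have hxω : x ∈ frontier ω := by
    rw [hω.frontier_eq]
    refine ⟨closure_mono hsub hx.2.1, fun hx' => hx.2.2 ?_⟩
    rw [← hωU, (hω.inter hU).interior_eq]
    exact ⟨hx', hx.1⟩
  rw [map_smul, htan x ⟨hx.1, hxω⟩, smul_zero]

theorem setIntegral_divergence_eq_zero_of_isTangentialNear [μ.IsAddHaarMeasure]
    (hω : IsOpen ω) (hωb : Bornology.IsBounded ω)
    (hVc : ContinuousOn V (closure ω)) (hV : ContDiffOn ℝ 1 V ω)
    (hdiv : IntegrableOn (divergence V) ω μ) (htan : ∀ p ∈ frontier ω, IsTangentialNear ω V p) :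
    ∫ x in ω, divergence V x ∂μ = 0 := by
  have hK : IsCompact (closure ω) := hωb.isCompact_closure
  have hloc : ∀ p ∈ closure ω, ∃ U ∈ 𝓝 p, IsOpen U ∧ ∀ ρ : E → ℝ, ContDiff ℝ 1 ρ →
      HasCompactSupport ρ → tsupport ρ ⊆ U →
        ∫ x in ω, divergence (fun y => ρ y • V y) x ∂μ = 0 := by
    intro p hp
    by_cases hpω : p ∈ ω
    · refine ⟨ω, hω.mem_nhds hpω, hω, fun ρ hρ hρc hρω => ?_⟩
      exact setIntegral_divergence_eq_zero_of_tsupport_subset hω (hρ.contDiffOn.smul hV)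
        hρc.smul_right ((tsupport_smul_subset_left ρ V).trans hρω)
    · exact (htan p (hω.frontier_eq ▸ ⟨hp, hpω⟩)).exists_setIntegral_divergence_smul_eq_zero
        hω hωb hVc hV hdiv
  choose! U hUp hUo hU using hloc
  obtain ⟨t, ht, hcov⟩ := hK.elim_nhds_subcover (fun p => U p ∩ Metric.ball p 1)
    fun p hp => inter_mem (hUp p hp) (Metric.ball_mem_nhds p one_pos)
  obtain ⟨ρ, hρU⟩ := SmoothPartitionOfUnity.exists_isSubordinate (modelWithCornersSelf ℝ E)
    isClosed_closure (fun p : t => U p ∩ Metric.ball (p : E) 1)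
    (fun p => (hUo _ (ht p p.2)).inter Metric.isOpen_ball) (by simpa [iUnion_subtype] using hcov)
  have hρ (i) : ContDiff ℝ 1 (ρ i) :=
    (ρ i).contMDiff.contDiff.of_le (by exact_mod_cast le_top)
  have hρc (i : t) : HasCompactSupport (ρ i) :=
    Metric.isCompact_of_isClosed_isBounded (isClosed_tsupport _)
      (Metric.isBounded_ball.subset ((hρU i).trans inter_subset_right))
  have hsum : ∀ x ∈ ω, ∑ i, ρ i x = 1 := fun x hx => by
    rw [← finsum_eq_sum_of_fintype, ρ.sum_eq_one (subset_closure hx)]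
  rw [setIntegral_congr_fun hω.measurableSet fun x => divergence_eq_sum_smul hρ hω hV hsum,
    integral_finsetSum _ fun i _ => integrableOn_divergence_smul hω hωb hVc hV hdiv (hρ i)]
  exact Finset.sum_eq_zero fun i _ => hU i (ht i i.2) _ (hρ i) (hρc i)
    ((hρU i).trans inter_subset_left)

end DivergenceTheorem

/-! ### The area formula for immersions -/

section LocalComparison

theorem le_of_forall_exists_nhds_le {X : Type*} [TopologicalSpace X]
    [SecondCountableTopology X] [MeasurableSpace X] [OpensMeasurableSpace X] {μ ν : Measure X}
    (h : ∀ x, ∃ s ∈ 𝓝 x, ∀ A ⊆ s, MeasurableSet A → μ A ≤ ν A) : μ ≤ ν := by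
  choose s hs hle using h
  obtain ⟨t, htc, hcov⟩ := TopologicalSpace.countable_cover_nhds fun x =>
    interior_mem_nhds.2 (hs x)
  have := htc.to_subtype
  have hle' (x : X) : μ.restrict (interior (s x)) ≤ ν.restrict (interior (s x)) := by
    refine Measure.le_iff.2 fun A hA => ?_
    rw [Measure.restrict_apply hA, Measure.restrict_apply hA]
    exact hle x _ (inter_subset_right.trans interior_subset)
      (hA.inter isOpen_interior.measurableSet)
  rw [← inf_eq_left,
    Measure.ext_iff_of_iUnion_eq_univ (s := fun x : t => interior (s x)) (by rwa [iUnion_subtype])]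
  intro x
  rw [← sInf_pair, Measure.restrict_sInf_eq_sInf_restrict (insert_nonempty _ _)
    isOpen_interior.measurableSet, image_pair, sInf_pair, inf_eq_left.2 (hle' x)]

theorem le_of_forall_one_lt_exists_nhds_le_pow_mul {X : Type*} [TopologicalSpace X]
    [SecondCountableTopology X] [MeasurableSpace X] [OpensMeasurableSpace X] {μ ν : Measure X}
    {d : ℕ} (h : ∀ c : NNReal, 1 < c → ∀ x, ∃ s ∈ 𝓝 x, ∀ A ⊆ s, MeasurableSet A →
      μ A ≤ c ^ d * ν A) : μ ≤ ν := by
  refine Measure.le_iff'.2 fun A => ?_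
  have hlim : Tendsto (fun c : NNReal => (c : ENNReal) ^ d * ν A) (𝓝[>] 1) (𝓝 (1 * ν A)) := by
    refine ENNReal.Tendsto.mul_const (Tendsto.mono_left ?_ nhdsWithin_le_nhds) (.inl one_ne_zero)
    simpa [Function.comp_def] using
      ((ENNReal.continuous_pow d).comp ENNReal.continuous_coe).tendsto (1 : NNReal)
  rw [← one_mul (ν A)]
  refine ge_of_tendsto hlim ?_
  filter_upwards [self_mem_nhdsWithin] with c hc
  exact le_of_forall_exists_nhds_le (ν := (c : ENNReal) ^ d • ν) (h c hc) A

/-- Factoring `f` through `g` on `A` gives a `K`-Lipschitz map from `g '' A` onto `f '' A`. -/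
theorem euclideanHausdorffMeasure_image_le_of_dist_le {X Y Z : Type*} [MetricSpace Y]
    [MeasurableSpace Y] [BorelSpace Y] [MetricSpace Z] [MeasurableSpace Z] [BorelSpace Z]
    {f : X → Y} {g : X → Z} {A : Set X} {K : NNReal}
    (h : ∀ x ∈ A, ∀ y ∈ A, dist (f x) (f y) ≤ K * dist (g x) (g y)) (d : ℕ) :
    μHE[d] (f '' A) ≤ (K : ENNReal) ^ d * μHE[d] (g '' A) := by
  rcases A.eq_empty_or_nonempty with rfl | ⟨x₀, -⟩
  · simp
  have : Nonempty X := ⟨x₀⟩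
  have hinv : ∀ z ∈ g '' A, Function.invFunOn g A z ∈ A ∧ g (Function.invFunOn g A z) = z :=
    fun z hz => ⟨Function.invFunOn_mem hz, Function.invFunOn_eq hz⟩
  have hL : LipschitzOnWith K (f ∘ Function.invFunOn g A) (g '' A) := by
    refine LipschitzOnWith.of_dist_le_mul fun z hz w hw => ?_
    have := h _ (hinv z hz).1 _ (hinv w hw).1
    rwa [(hinv z hz).2, (hinv w hw).2] at this
  have himg : (f ∘ Function.invFunOn g A) '' (g '' A) = f '' A := by
    rw [image_image]
    refine image_congr fun x hx => ?_
    have hx' := hinv (g x) (mem_image_of_mem g hx)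
    have := h _ hx'.1 x hx
    rw [hx'.2, dist_self, mul_zero] at this
    exact dist_le_zero.1 this
  have := hL.hausdorffMeasure_image_le (d := d) d.cast_nonneg
  rw [himg, ENNReal.rpow_natCast] at this
  simp only [Measure.euclideanHausdorffMeasure_def, Measure.smul_apply, ENNReal.smul_def,
    smul_eq_mul]
  rw [mul_left_comm]
  gcongr

theorem eventually_dist_le_mul_dist_of_hasStrictFDerivAt {E F : Type*} [NormedAddCommGroup E]
    [NormedSpace ℝ E] [FiniteDimensional ℝ E] [NormedAddCommGroup F] [NormedSpace ℝ F]
    {f : E → F} {f' : E →L[ℝ] F} {p : E} (hf : HasStrictFDerivAt f f' p)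
    (hf' : Function.Injective f') {c : ℝ} (hc : 1 < c) :
    ∀ᶠ q : E × E in 𝓝 (p, p), dist (f q.1) (f q.2) ≤ c * dist (f' q.1) (f' q.2) ∧
      dist (f' q.1) (f' q.2) ≤ c * dist (f q.1) (f q.2) := by
  obtain ⟨K, -, hK⟩ := f'.toLinearMap.exists_antilipschitzWith (LinearMap.ker_eq_bot.2 hf')
  have hO : (fun q : E × E => q.1 - q.2) =O[𝓝 (p, p)] fun q => f' (q.1 - q.2) :=
    Asymptotics.IsBigO.of_bound K (Eventually.of_forall fun q => by
      simpa [dist_eq_norm] using hK.le_mul_dist q.1 q.2)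
  have hη : 0 < 1 - c⁻¹ := sub_pos.2 (inv_lt_one_of_one_lt₀ hc)
  filter_upwards [(hf.isLittleO.trans_isBigO hO).bound hη] with q hq
  have hc₀ : 0 < c := by linarith
  have hc₂ : 1 + (1 - c⁻¹) ≤ c := by
    have : 0 ≤ (c - 1) ^ 2 / c := by positivity
    field_simp at this ⊢
    nlinarith
  simp only [dist_eq_norm, ← map_sub]
  set u := f q.1 - f q.2
  set v := f' (q.1 - q.2)
  have huv := norm_sub_norm_le u v
  have hvu : ‖v‖ - ‖u‖ ≤ ‖u - v‖ := norm_sub_rev u v ▸ norm_sub_norm_le v u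
  refine ⟨by nlinarith [norm_nonneg v], ?_⟩
  have : c⁻¹ * ‖v‖ ≤ ‖u‖ := by linarith
  rwa [inv_mul_le_iff₀ hc₀] at this

end LocalComparison

section AreaFormula

variable {E F : Type*} [NormedAddCommGroup E] [InnerProductSpace ℝ E] [FiniteDimensional ℝ E]
  [NormedAddCommGroup F] [InnerProductSpace ℝ F] {f : E → F} {ω : Set E}

/-- The Jacobian of `f`: the factor by which `f` multiplies the `dim E`-dimensional measure
infinitesimally. -/
def jacobian (f : E → F) (x : E) : ℝ :=
  (fderiv ℝ f x).toLinearMap.normDet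

theorem jacobian_nonneg (f : E → F) (x : E) : 0 ≤ jacobian f x :=
  LinearMap.normDet_nonneg _

theorem jacobian_pos {x : E} (hf : Function.Injective (fderiv ℝ f x)) : 0 < jacobian f x :=
  (jacobian_nonneg f x).lt_of_ne' fun h =>
    LinearMap.normDet_eq_zero_iff_ker_ne_bot.1 h (LinearMap.ker_eq_bot.2 hf)

theorem continuousOn_jacobian [CompleteSpace F] (hω : IsOpen ω) (hf : ContDiffOn ℝ 1 f ω) :
    ContinuousOn (jacobian f) ω := by
  have : CompleteSpace E := FiniteDimensional.complete ℝ E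
  have h : Continuous fun T : E →L[ℝ] F => √(ContinuousLinearMap.adjoint T ∘L T).det :=
    Real.continuous_sqrt.comp (ContinuousLinearMap.continuous_det.comp
      (ContinuousLinearMap.adjoint.continuous.clm_comp continuous_id))
  refine (h.comp_continuousOn (hf.continuousOn_fderiv_of_isOpen hω le_rfl)).congr fun x _ => ?_
  rw [Function.comp_apply, ← ContinuousLinearMap.normDet_sq]
  exact (Real.sqrt_sq (jacobian_nonneg f x)).symm

variable [MeasurableSpace E] [BorelSpace E]

theorem aemeasurable_jacobian [CompleteSpace F] (hω : IsOpen ω) (hf : ContDiffOn ℝ 1 f ω) :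
    AEMeasurable (fun x => (jacobian f x).toNNReal) (volume.restrict ω) :=
  ((continuousOn_jacobian hω hf).aemeasurable hω.measurableSet).real_toNNReal

/-- The Lebesgue measure weighted by the Jacobian of `f`. -/
def jacobianMeasure (f : E → F) : Measure E :=
  volume.withDensity fun x => ENNReal.ofReal (jacobian f x)

theorem exists_nhds_forall_jacobianMeasure_le {p : E} (hf : ContinuousAt (jacobian f) p)
    (hp : 0 < jacobian f p) {c : NNReal} (hc : 1 < c) :
    ∃ s ∈ 𝓝 p, ∀ A ⊆ s, MeasurableSet A →
      jacobianMeasure f A ≤ c * (ENNReal.ofReal (jacobian f p) * volume A) ∧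
      ENNReal.ofReal (jacobian f p) * volume A ≤ c * jacobianMeasure f A := by
  have hc' : (1 : ℝ) < c := hc
  have h₁ : ∀ᶠ x in 𝓝 p, jacobian f x < c * jacobian f p :=
    hf.eventually_lt_const (lt_mul_of_one_lt_left hp hc')
  have h₂ : ∀ᶠ x in 𝓝 p, jacobian f p < c * jacobian f x :=
    (hf.const_mul (c : ℝ)).eventually_const_lt (lt_mul_of_one_lt_left hp hc')
  have hofReal {a b : ℝ} (h : a < c * b) : ENNReal.ofReal a ≤ c * ENNReal.ofReal b := by
    rw [← ENNReal.ofReal_coe_nnreal, ← ENNReal.ofReal_mul c.coe_nonneg]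
    exact ENNReal.ofReal_le_ofReal h.le
  refine ⟨_, inter_mem h₁ h₂, fun A hA hAm => ?_⟩
  rw [jacobianMeasure, withDensity_apply _ hAm, ← setLIntegral_const,
    ← lintegral_const_mul' _ _ ENNReal.coe_ne_top, ← lintegral_const_mul' _ _ ENNReal.coe_ne_top]
  exact ⟨setLIntegral_mono' hAm fun x hx => hofReal (hA hx).1,
    setLIntegral_mono' hAm fun x hx => hofReal (hA hx).2⟩

variable [MeasurableSpace F] [BorelSpace F]

theorem exists_nhds_forall_measure_image_le {p : E} (hf : ContDiffAt ℝ 1 f p)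
    (hf' : Function.Injective (fderiv ℝ f p)) {c : NNReal} (hc : 1 < c) :
    ∃ s ∈ 𝓝 p, ∀ A ⊆ s,
      μHE[Module.finrank ℝ E] (f '' A) ≤
        c ^ Module.finrank ℝ E * (ENNReal.ofReal (jacobian f p) * volume A) ∧
      ENNReal.ofReal (jacobian f p) * volume A ≤
        c ^ Module.finrank ℝ E * μHE[Module.finrank ℝ E] (f '' A) := by
  have h := eventually_dist_le_mul_dist_of_hasStrictFDerivAt (hf.hasStrictFDerivAt one_ne_zero) hf'
    (NNReal.coe_lt_coe.2 hc)
  rw [nhds_prod_eq] at h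
  obtain ⟨s, hs, h⟩ := mem_prod_self_iff.1 h
  refine ⟨s, hs, fun A hA => ?_⟩
  have hvol : ENNReal.ofReal (jacobian f p) * volume A =
      μHE[Module.finrank ℝ E] (fderiv ℝ f p '' A) :=
    (LinearMap.euclideanHausdorffMeasure_image_eq_normDet_mul_volume _ A).symm
  rw [hvol]
  exact ⟨euclideanHausdorffMeasure_image_le_of_dist_le
      (fun x hx y hy => (h (mk_mem_prod (hA hx) (hA hy))).1) _,
    euclideanHausdorffMeasure_image_le_of_dist_le
      (fun x hx y hy => (h (mk_mem_prod (hA hx) (hA hy))).2) _⟩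

theorem exists_nhds_forall_measure_image_le_jacobianMeasure [CompleteSpace F] (hω : IsOpen ω)
    (hf : ContDiffOn ℝ 1 f ω) (hf' : ∀ x ∈ ω, Function.Injective (fderiv ℝ f x)) {p : E}
    (hp : p ∈ ω) {c : NNReal} (hc : 1 < c) :
    ∃ s ∈ 𝓝 p, ∀ A ⊆ s, MeasurableSet A →
      μHE[Module.finrank ℝ E] (f '' A) ≤ c ^ (Module.finrank ℝ E + 1) * jacobianMeasure f A ∧
      jacobianMeasure f A ≤ c ^ (Module.finrank ℝ E + 1) * μHE[Module.finrank ℝ E] (f '' A) := by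
  obtain ⟨s, hs, hsA⟩ :=
    exists_nhds_forall_measure_image_le (hf.contDiffAt (hω.mem_nhds hp)) (hf' p hp) hc
  obtain ⟨t, ht, htA⟩ := exists_nhds_forall_jacobianMeasure_le
    ((continuousOn_jacobian hω hf).continuousAt (hω.mem_nhds hp)) (jacobian_pos (hf' p hp)) hc
  refine ⟨s ∩ t, inter_mem hs ht, fun A hA hAm => ?_⟩
  obtain ⟨hs₁, hs₂⟩ := hsA A (hA.trans inter_subset_left)
  obtain ⟨ht₁, ht₂⟩ := htA A (hA.trans inter_subset_right) hAm
  rw [pow_succ]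
  constructor
  · calc
      _ ≤ _ := hs₁
      _ ≤ _ := mul_le_mul_right ht₂ _
      _ = _ := (mul_assoc _ _ _).symm
  · calc
      _ ≤ _ := ht₁
      _ ≤ _ := mul_le_mul_right hs₂ _
      _ = _ := by rw [← mul_assoc, mul_comm (c : ENNReal)]

theorem comap_euclideanHausdorffMeasure_eq [CompleteSpace F] (hω : IsOpen ω)
    (hf : ContDiffOn ℝ 1 f ω) (hf' : ∀ x ∈ ω, Function.Injective (fderiv ℝ f x))
    (hinj : InjOn f ω) :
    (μHE[Module.finrank ℝ E]).comap (ω.domRestrict f) = (jacobianMeasure f).comap (↑) := by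
  have hemb := hf.continuousOn.measurableEmbedding hω.measurableSet hinj
  have hcoe := MeasurableEmbedding.subtype_coe hω.measurableSet
  have hloc (c : NNReal) (hc : 1 < c) (p : ω) : ∃ s ∈ 𝓝 p, ∀ A ⊆ s, MeasurableSet A →
      (μHE[Module.finrank ℝ E]).comap (ω.domRestrict f) A ≤
        c ^ (Module.finrank ℝ E + 1) * (jacobianMeasure f).comap (↑) A ∧
      (jacobianMeasure f).comap (↑) A ≤
        c ^ (Module.finrank ℝ E + 1) * (μHE[Module.finrank ℝ E]).comap (ω.domRestrict f) A := by
    obtain ⟨s, hs, hsA⟩ :=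
      exists_nhds_forall_measure_image_le_jacobianMeasure hω hf hf' p.2 hc
    refine ⟨(↑) ⁻¹' s, continuous_subtype_val.continuousAt.preimage_mem_nhds hs, fun A hA hAm => ?_⟩
    rw [hemb.comap_apply, hcoe.comap_apply, domRestrict_eq, image_comp]
    exact hsA _ (image_subset_iff.2 hA) (hcoe.measurableSet_image.2 hAm)
  have hle := fun c hc p => (hloc c hc p).imp fun s hs =>
    hs.imp_right fun h A hA hAm => (h A hA hAm).1
  have hge := fun c hc p => (hloc c hc p).imp fun s hs =>
    hs.imp_right fun h A hA hAm => (h A hA hAm).2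
  exact (le_of_forall_one_lt_exists_nhds_le_pow_mul hle).antisymm
    (le_of_forall_one_lt_exists_nhds_le_pow_mul hge)

theorem map_domRestrict_comap_jacobianMeasure [CompleteSpace F] (hω : IsOpen ω)
    (hf : ContDiffOn ℝ 1 f ω) (hf' : ∀ x ∈ ω, Function.Injective (fderiv ℝ f x))
    (hinj : InjOn f ω) :
    ((jacobianMeasure f).comap ((↑) : ω → E)).map (ω.domRestrict f) =
      (μHE[Module.finrank ℝ E]).restrict (f '' ω) := by
  rw [← comap_euclideanHausdorffMeasure_eq hω hf hf' hinj,
    (hf.continuousOn.measurableEmbedding hω.measurableSet hinj).map_comap, range_domRestrict]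

variable {G : Type*} [NormedAddCommGroup G] [NormedSpace ℝ G]

theorem integrableOn_image_iff_integrableOn_jacobian_smul [CompleteSpace F] (hω : IsOpen ω)
    (hf : ContDiffOn ℝ 1 f ω) (hf' : ∀ x ∈ ω, Function.Injective (fderiv ℝ f x))
    (hinj : InjOn f ω) (g : F → G) :
    IntegrableOn g (f '' ω) μHE[Module.finrank ℝ E] ↔
      IntegrableOn (fun x => jacobian f x • g (f x)) ω := by
  have hωm := hω.measurableSet
  rw [IntegrableOn, ← map_domRestrict_comap_jacobianMeasure hω hf hf' hinj,
    (hf.continuousOn.measurableEmbedding hωm hinj).integrable_map_iff, domRestrict_eq,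
    ← Function.comp_assoc, ← (MeasurableEmbedding.subtype_coe hωm).integrable_map_iff,
    map_comap_subtype_coe hωm, jacobianMeasure, restrict_withDensity hωm]
  simp only [ENNReal.ofReal]
  rw [integrable_withDensity_iff_integrable_coe_smul₀ (aemeasurable_jacobian hω hf)]
  simp_rw [IntegrableOn, Real.coe_toNNReal _ (jacobian_nonneg f _), Function.comp_apply]

theorem setIntegral_image_eq_setIntegral_jacobian_smul [CompleteSpace F] (hω : IsOpen ω)
    (hf : ContDiffOn ℝ 1 f ω) (hf' : ∀ x ∈ ω, Function.Injective (fderiv ℝ f x))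
    (hinj : InjOn f ω) (g : F → G) :
    ∫ x in f '' ω, g x ∂μHE[Module.finrank ℝ E] = ∫ x in ω, jacobian f x • g (f x) := by
  have hωm := hω.measurableSet
  rw [← map_domRestrict_comap_jacobianMeasure hω hf hf' hinj,
    (hf.continuousOn.measurableEmbedding hωm hinj).integral_map]
  simp only [domRestrict_apply, ← Function.comp_apply (f := g), jacobianMeasure, ENNReal.ofReal]
  rw [← (MeasurableEmbedding.subtype_coe hωm).integral_map, map_comap_subtype_coe hωm,
    setIntegral_withDensity_eq_setIntegral_smul₀ (aemeasurable_jacobian hω hf) _ hωm]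
  simp_rw [NNReal.smul_def, Real.coe_toNNReal _ (jacobian_nonneg f _)]

end AreaFormula

section IntegrationByParts

variable {E : Type*} [NormedAddCommGroup E]

theorem IsTangentialNear.smul [NormedSpace ℝ E] {ω : Set E} {V : E → E} {p : E}
    (h : IsTangentialNear ω V p) (φ : E → ℝ) : IsTangentialNear ω (fun y => φ y • V y) p := by
  obtain ⟨U, g, hU, hpU, hg, hω, hgp, htan⟩ := h
  exact ⟨U, g, hU, hpU, hg, hω, hgp, fun x hx => by rw [map_smul, htan x hx, smul_zero]⟩

theorem setIntegral_mul_divergence_eq_neg [NormedSpace ℝ E] [FiniteDimensional ℝ E]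
    [MeasurableSpace E] [BorelSpace E] {μ : Measure E} [μ.IsAddHaarMeasure] {ω : Set E}
    (hω : IsOpen ω) (hωb : Bornology.IsBounded ω) {φ : E → ℝ} {V : E → E}
    (hφc : ContinuousOn φ (closure ω)) (hφ : ContDiffOn ℝ 1 φ ω)
    (hVc : ContinuousOn V (closure ω)) (hV : ContDiffOn ℝ 1 V ω)
    (hφV : IntegrableOn (fun y => φ y * divergence V y) ω μ)
    (hφ'V : IntegrableOn (fun y => fderiv ℝ φ y (V y)) ω μ)
    (htan : ∀ p ∈ frontier ω, IsTangentialNear ω V p) :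
    ∫ y in ω, φ y * divergence V y ∂μ = -∫ y in ω, fderiv ℝ φ y (V y) ∂μ := by
  have hdiv : EqOn (divergence fun y => φ y • V y)
      (fun y => φ y * divergence V y + fderiv ℝ φ y (V y)) ω := fun y hy =>
    divergence_smul ((hφ.contDiffAt (hω.mem_nhds hy)).differentiableAt one_ne_zero)
      ((hV.contDiffAt (hω.mem_nhds hy)).differentiableAt one_ne_zero)
  have h := setIntegral_divergence_eq_zero_of_isTangentialNear (V := fun y => φ y • V y) hω hωb
    (hφc.smul hVc) (hφ.smul hV) ((hφV.add hφ'V).congr_fun hdiv.symm hω.measurableSet)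
    fun p hp => (htan p hp).smul φ
  rw [setIntegral_congr_fun hω.measurableSet hdiv, integral_add hφV hφ'V] at h
  exact eq_neg_of_add_eq_zero_left h

variable [InnerProductSpace ℝ E] [CompleteSpace E]

theorem gradient_ne_zero_iff {g : E → ℝ} {x : E} : gradient g x ≠ 0 ↔ fderiv ℝ g x ≠ 0 := by
  simp [gradient]

theorem IsLocalDefiningFunction.of_le {k l : ℕ∞} {ω : Set E} {p : E} {g : E → ℝ}
    (hg : IsLocalDefiningFunction l ω p g) (hkl : k ≤ l) : IsLocalDefiningFunction k ω p g :=
  let ⟨U, hU, hpU, hgU, h⟩ := hg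
  ⟨U, hU, hpU, hgU.of_le (by exact_mod_cast hkl), h⟩

theorem eventually_isLocalDefiningFunction {k : ℕ∞} (hk : 1 ≤ k) {ω : Set E} (hω : IsOpen ω)
    {p : E} {g : E → ℝ} (hg : IsLocalDefiningFunction k ω p g) :
    ∀ᶠ x in 𝓝 p, x ∈ frontier ω → IsLocalDefiningFunction k ω x g := by
  obtain ⟨U, hU, hpU, hgU, hωU, -, hgp⟩ := hg
  have hg' : ContinuousAt (fderiv ℝ g) p :=
    (hgU.continuousOn_fderiv_of_isOpen hU (by exact_mod_cast hk)).continuousAt (hU.mem_nhds hpU)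
  filter_upwards [hU.mem_nhds hpU, hg'.eventually_ne (gradient_ne_zero_iff.1 hgp)] with x hxU hgx hx
  rw [hω.frontier_eq] at hx
  refine ⟨U, hU, hxU, hgU, hωU, le_antisymm ?_ (not_lt.1 fun h => hx.2 ((hωU x hxU).2 h)),
    gradient_ne_zero_iff.2 hgx⟩
  have : (𝓝[U ∩ ω] x).NeBot :=
    mem_closure_iff_nhdsWithin_neBot.1 (hU.inter_closure ⟨hxU, hx.1⟩)
  refine le_of_tendsto ((hgU.continuousOn x hxU).mono (inter_subset_left (t := ω))) ?_
  filter_upwards [self_mem_nhdsWithin] with y hy using ((hωU y hy.1).1 hy.2).le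

theorem isTangentialNear_of_inner_gradient_eq_zero {ω : Set E} (hω : IsOpen ω) {V : E → E} {p : E}
    {g : E → ℝ} (hg : IsLocalDefiningFunction 1 ω p g)
    (hV : ∀ x ∈ frontier ω, IsLocalDefiningFunction 1 ω x g → ⟪gradient g x, V x⟫ = 0) :
    IsTangentialNear ω V p := by
  obtain ⟨U', hU', hU'o, hpU'⟩ :=
    eventually_nhds_iff.1 (eventually_isLocalDefiningFunction le_rfl hω hg)
  obtain ⟨U, hU, hpU, hgU, hωU, -, hgp⟩ := hg
  refine ⟨U ∩ U', g, hU.inter hU'o, ⟨hpU, hpU'⟩, hgU.mono inter_subset_left,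
    fun x hx => hωU x hx.1, gradient_ne_zero_iff.1 hgp, fun x hx => ?_⟩
  rw [← inner_gradient_left]
  exact hV x hx.2 (hU' x hx.1.2 hx.2)

end IntegrationByParts

/-! ### Normals of graphs and cylinders -/

section Coordinates

variable {n : ℕ}

@[simp]
theorem base_graphMap (φ : EuclideanSpace ℝ (Fin n) → ℝ) (y : EuclideanSpace ℝ (Fin n)) :
    base (graphMap φ y) = y := by
  ext i; simp [base, graphMap]

@[simp]
theorem height_graphMap (φ : EuclideanSpace ℝ (Fin n) → ℝ) (y : EuclideanSpace ℝ (Fin n)) :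
    height (graphMap φ y) = φ y := by
  simp [height, graphMap]

theorem ext_base_height {x z : EuclideanSpace ℝ (Fin (n + 1))} (h : base x = base z)
    (h' : height x = height z) : x = z := by
  ext i
  refine Fin.lastCases h' (fun j => ?_) i
  exact congrArg (fun v : EuclideanSpace ℝ (Fin n) => v j) h

theorem inner_eq_base_add_height (x y : EuclideanSpace ℝ (Fin (n + 1))) :
    ⟪x, y⟫ = ⟪base x, base y⟫ + height x * height y := by
  simp [PiLp.inner_apply, Fin.sum_univ_castSucc, base, height, mul_comm]

theorem continuous_base : Continuous (base (n := n)) := by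
  unfold base; fun_prop

/-- The projection `x ↦ x'`, as a continuous linear map. -/
def baseCLM : EuclideanSpace ℝ (Fin (n + 1)) →L[ℝ] EuclideanSpace ℝ (Fin n) where
  toFun := base
  map_add' x y := by ext i; simp [base]
  map_smul' c x := by ext i; simp [base]
  cont := continuous_base

@[simp]
theorem baseCLM_apply (x : EuclideanSpace ℝ (Fin (n + 1))) : baseCLM x = base x := rfl

@[simp]
theorem base_add (x y : EuclideanSpace ℝ (Fin (n + 1))) : base (x + y) = base x + base y :=
  map_add baseCLM x y

@[simp]
theorem base_sub (x y : EuclideanSpace ℝ (Fin (n + 1))) : base (x - y) = base x - base y :=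
  map_sub baseCLM x y

@[simp]
theorem base_smul (c : ℝ) (x : EuclideanSpace ℝ (Fin (n + 1))) : base (c • x) = c • base x :=
  map_smul baseCLM c x

@[simp]
theorem base_eLast : base (eLast (n := n)) = 0 := by
  ext i; simp [base, eLast]

@[simp]
theorem height_add (x y : EuclideanSpace ℝ (Fin (n + 1))) :
    height (x + y) = height x + height y := rfl

@[simp]
theorem height_sub (x y : EuclideanSpace ℝ (Fin (n + 1))) :
    height (x - y) = height x - height y := rfl

@[simp]
theorem height_smul (c : ℝ) (x : EuclideanSpace ℝ (Fin (n + 1))) :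
    height (c • x) = c * height x := rfl

@[simp]
theorem height_eLast : height (eLast (n := n)) = 1 := by
  simp [height, eLast]

/-- The inclusion `x' ↦ (x', 0)`, as a linear isometry. -/
def horizontal : EuclideanSpace ℝ (Fin n) →ₗᵢ[ℝ] EuclideanSpace ℝ (Fin (n + 1)) where
  toFun := graphMap fun _ => 0
  map_add' x y := ext_base_height (by simp) (by simp)
  map_smul' c x := ext_base_height (by simp) (by simp)
  norm_map' x := by
    simp [EuclideanSpace.norm_eq, Fin.sum_univ_castSucc, graphMap]

@[simp]
theorem base_horizontal (v : EuclideanSpace ℝ (Fin n)) : base (horizontal v) = v :=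
  base_graphMap (fun _ => 0) v

@[simp]
theorem height_horizontal (v : EuclideanSpace ℝ (Fin n)) : height (horizontal v) = 0 :=
  height_graphMap (fun _ => 0) v

theorem graphMap_eq (φ : EuclideanSpace ℝ (Fin n) → ℝ) :
    graphMap φ = fun y => horizontal y + φ y • eLast :=
  funext fun _ => ext_base_height (by simp) (by simp)

theorem hasGradientAt_height (x : EuclideanSpace ℝ (Fin (n + 1))) :
    HasGradientAt height eLast x := by
  have h : (height : EuclideanSpace ℝ (Fin (n + 1)) → ℝ) =
      InnerProductSpace.toDual ℝ _ (eLast (n := n)) := by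
    ext y; simp [inner_eq_base_add_height]
  rw [hasGradientAt_iff_hasFDerivAt, h]
  exact ContinuousLinearMap.hasFDerivAt _

theorem contDiff_height {k : WithTop ℕ∞} : ContDiff ℝ k (height (n := n)) := by
  unfold height; fun_prop

theorem hasGradientAt_comp_base {f : EuclideanSpace ℝ (Fin n) → ℝ}
    {x : EuclideanSpace ℝ (Fin (n + 1))} (hf : DifferentiableAt ℝ f (base x)) :
    HasGradientAt (fun z => f (base z)) (horizontal (gradient f (base x))) x := by
  rw [hasGradientAt_iff_hasFDerivAt]
  refine (hf.hasFDerivAt.comp x (baseCLM (n := n)).hasFDerivAt).congr_fderiv ?_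
  ext v
  simp [inner_eq_base_add_height]

end Coordinates

section Normals

variable {n : ℕ} {ω : Set (EuclideanSpace ℝ (Fin n))} {φ : EuclideanSpace ℝ (Fin n) → ℝ}

theorem norm_eLast_sub_horizontal (v : EuclideanSpace ℝ (Fin n)) :
    ‖eLast - horizontal v‖ = √(1 + ‖v‖ ^ 2) := by
  rw [norm_eq_sqrt_real_inner, inner_eq_base_add_height]
  simp [add_comm]

/-- The upward unit normal `(-v, 1) / √(1 + |v|²)` of a hyperplane with slope `v`. -/
def slopeNormal (v : EuclideanSpace ℝ (Fin n)) : EuclideanSpace ℝ (Fin (n + 1)) :=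
  (√(1 + ‖v‖ ^ 2))⁻¹ • (eLast - horizontal v)

theorem continuous_slopeNormal : Continuous (slopeNormal (n := n)) := by
  have : ∀ v : EuclideanSpace ℝ (Fin n), √(1 + ‖v‖ ^ 2) ≠ 0 := fun v => by positivity
  unfold slopeNormal
  fun_prop (disch := assumption)

theorem isOpen_cylinder (hω : IsOpen ω) : IsOpen (cylinder ω) :=
  (hω.preimage continuous_base).inter <|
    isOpen_lt continuous_const (contDiff_height (k := 0)).continuous

theorem graph_subset_cylinder (hpos : ∀ y ∈ ω, 0 < φ y) : graph ω φ ⊆ cylinder ω :=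
  fun _ hx => ⟨hx.1, hx.2 ▸ hpos _ hx.1⟩

theorem outerUnitNormal_subgraph (hω : IsOpen ω) (hφ : ContDiffOn ℝ 1 φ ω)
    (hpos : ∀ y ∈ ω, 0 < φ y) {x : EuclideanSpace ℝ (Fin (n + 1))} (hx : x ∈ graph ω φ) :
    outerUnitNormal (subgraph ω φ) x = slopeNormal (gradient φ (base x)) := by
  have hd : DifferentiableAt ℝ φ (base x) :=
    (hφ.contDiffAt (hω.mem_nhds hx.1)).differentiableAt one_ne_zero
  have hgrad : gradient (fun z => height z - φ (base z)) x =
      eLast - horizontal (gradient φ (base x)) := by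
    refine HasGradientAt.gradient ?_
    rw [hasGradientAt_iff_hasFDerivAt, map_sub]
    exact (hasGradientAt_height x).hasFDerivAt.sub (hasGradientAt_comp_base hd).hasFDerivAt
  refine outerUnitNormal_eq ⟨fun z => height z - φ (base z),
    ⟨cylinder ω, isOpen_cylinder hω, graph_subset_cylinder hpos hx, ?_, ?_, ?_, ?_⟩, ?_⟩
  · exact contDiff_height.contDiffOn.sub
      (hφ.comp (baseCLM (n := n)).contDiff.contDiffOn fun z hz => hz.1)
  · intro z hz
    simp [subgraph, hz]
  · simp [hx.2]
  · rw [hgrad, ← norm_pos_iff, norm_eLast_sub_horizontal]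
    positivity
  · rw [hgrad, norm_eLast_sub_horizontal, slopeNormal]

theorem graphNormal_eq_slopeNormal (hω : IsOpen ω) (hφ : ContDiffOn ℝ 1 φ ω)
    (hpos : ∀ y ∈ ω, 0 < φ y) {G : EuclideanSpace ℝ (Fin n) → EuclideanSpace ℝ (Fin n)}
    (hG : ContinuousOn G (closure ω)) (hGφ : EqOn G (gradient φ) ω)
    {x : EuclideanSpace ℝ (Fin (n + 1))} (hx : x ∈ closure (graph ω φ)) :
    graphNormal ω φ x = slopeNormal (G (base x)) := by
  have hmaps : MapsTo base (graph ω φ) (closure ω) := fun z hz => subset_closure hz.1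
  have hbx : base x ∈ closure ω := map_mem_closure continuous_base hx fun z hz => hz.1
  have hlim : Tendsto (fun z => slopeNormal (G (base z))) (𝓝[graph ω φ] x)
      (𝓝 (slopeNormal (G (base x)))) :=
    (continuous_slopeNormal.tendsto _).comp ((hG (base x) hbx).tendsto.comp
      (continuous_base.continuousWithinAt.tendsto_nhdsWithin hmaps))
  refine extendFrom_eq hx (hlim.congr' ?_)
  filter_upwards [self_mem_nhdsWithin] with z hz
  rw [outerUnitNormal_subgraph hω hφ hpos hz, hGφ hz.1]

theorem outerUnitNormal_cylinder {x : EuclideanSpace ℝ (Fin (n + 1))} (hx : 0 < height x)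
    {g : EuclideanSpace ℝ (Fin n) → ℝ} (hg : IsLocalDefiningFunction 1 ω (base x) g) :
    outerUnitNormal (cylinder ω) x =
      ‖gradient g (base x)‖⁻¹ • horizontal (gradient g (base x)) := by
  obtain ⟨U, hU, hpU, hgU, hgω, hg0, hg'⟩ := hg
  have hgrad := (hasGradientAt_comp_base
    ((hgU.contDiffAt (hU.mem_nhds hpU)).differentiableAt one_ne_zero)).gradient
  refine outerUnitNormal_eq ⟨fun z => g (base z), ⟨cylinder U, isOpen_cylinder hU, ⟨hpU, hx⟩,
    hgU.comp (baseCLM (n := n)).contDiff.contDiffOn fun z hz => hz.1, ?_, hg0, ?_⟩, ?_⟩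
  · intro z hz
    simp [cylinder, hz.2, hgω _ hz.1]
  · rw [hgrad, ← norm_ne_zero_iff, horizontal.norm_map]
    exact norm_ne_zero_iff.2 hg'
  · rw [hgrad, horizontal.norm_map]

theorem graphMap_mem_closure_graph (hφ : ContinuousOn φ (closure ω))
    {p : EuclideanSpace ℝ (Fin n)} (hp : p ∈ closure ω) :
    graphMap φ p ∈ closure (graph ω φ) := by
  have hφp : ContinuousWithinAt φ ω p := (hφ p hp).mono subset_closure
  have h : ContinuousWithinAt (graphMap φ) ω p := by
    rw [graphMap_eq]
    fun_prop
  exact h.mem_closure hp fun y hy => by simpa [graph] using hy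

theorem graphMap_mem_lateralBoundary (hω : IsOpen ω) (hφ : ContinuousOn φ (closure ω))
    (hpos : ∀ y ∈ closure ω, 0 < φ y) {p : EuclideanSpace ℝ (Fin n)} (hp : p ∈ frontier ω) :
    graphMap φ p ∈ lateralBoundary ω := by
  rw [hω.frontier_eq] at hp
  refine ⟨(isOpen_cylinder hω).frontier_eq ▸ ⟨?_, fun h => hp.2 (by simpa using h.1)⟩,
    by simpa using hpos p hp.1⟩
  exact closure_mono (graph_subset_cylinder fun y hy => hpos y (subset_closure hy))
    (graphMap_mem_closure_graph hφ hp.1)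

theorem MeetsOrthogonally.inner_gradient_eq_zero (horth : MeetsOrthogonally ω φ) (hω : IsOpen ω)
    (hφ : ContDiffOn ℝ 1 φ ω) (hφc : ContinuousOn φ (closure ω)) (hpos : ∀ y ∈ closure ω, 0 < φ y)
    {G : EuclideanSpace ℝ (Fin n) → EuclideanSpace ℝ (Fin n)} (hG : ContinuousOn G (closure ω))
    (hGφ : EqOn G (gradient φ) ω) {p : EuclideanSpace ℝ (Fin n)} (hp : p ∈ frontier ω)
    {g : EuclideanSpace ℝ (Fin n) → ℝ} (hg : IsLocalDefiningFunction 1 ω p g) :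
    ⟪gradient g p, G p⟫ = 0 := by
  have hx := graphMap_mem_closure_graph hφc (frontier_subset_closure hp)
  have hlat := graphMap_mem_lateralBoundary hω hφc hpos hp
  have h := horth _ ⟨hx, hlat⟩
  rw [graphNormal_eq_slopeNormal hω hφ (fun y hy => hpos y (subset_closure hy)) hG hGφ hx,
    outerUnitNormal_cylinder hlat.2 (g := g) (by simpa using hg)] at h
  have hg' : gradient g p ≠ 0 := let ⟨_, _, _, _, _, _, h⟩ := hg; h
  have hW : √(1 + ‖G p‖ ^ 2) ≠ 0 := by positivity
  simpa [slopeNormal, inner_smul_left, inner_smul_right, inner_eq_base_add_height, inner_neg_left,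
    real_inner_comm, hg', hW] using h

end Normals

/-! ### Area and mean curvature of graphs -/

section Tilt

variable {E : Type*} [NormedAddCommGroup E] [InnerProductSpace ℝ E]

/-- The horizontal part `v / √(1 + |v|²)` of the downward unit normal of a hyperplane with
slope `v`. Applied to `∇φ` it gives the vector field whose divergence is, up to the factor `-n`, the
mean curvature of the graph of `φ`. -/
def tilt (v : E) : E :=
  (√(1 + ‖v‖ ^ 2))⁻¹ • v

theorem contDiff_tilt {k : ℕ∞} : ContDiff ℝ k (tilt : E → E) :=
  OpenPartialHomeomorph.contDiff_univUnitBall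

theorem inner_tilt_right (v : E) : ⟪v, tilt v⟫ = ‖v‖ ^ 2 / √(1 + ‖v‖ ^ 2) := by
  rw [tilt, inner_smul_right, real_inner_self_eq_norm_sq, div_eq_inv_mul]

theorem hasFDerivAt_inv_sqrt_one_add_norm_sq {V : E → E} {y : E} (hV : DifferentiableAt ℝ V y) :
    HasFDerivAt (fun x => (√(1 + ‖V x‖ ^ 2))⁻¹)
      (-((√(1 + ‖V y‖ ^ 2))⁻¹ * (1 + ‖V y‖ ^ 2)⁻¹) • (innerSL ℝ (V y)).comp (fderiv ℝ V y)) y := by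
  have hpos : 0 < √(1 + ‖V y‖ ^ 2) := by positivity
  refine ((hasDerivAt_inv hpos.ne').comp_hasFDerivAt y
    ((hV.hasFDerivAt.norm_sq.const_add 1).sqrt (by positivity))).congr_fderiv ?_
  rw [Real.sq_sqrt (by positivity), smul_smul]
  match_scalars
  field_simp

theorem divergence_tilt_comp [FiniteDimensional ℝ E] {V : E → E} {y : E}
    (hV : DifferentiableAt ℝ V y) :
    divergence (fun x => tilt (V x)) y = (√(1 + ‖V y‖ ^ 2))⁻¹ *
      (divergence V y - (1 + ‖V y‖ ^ 2)⁻¹ * ⟪V y, fderiv ℝ V y (V y)⟫) := by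
  have h := hasFDerivAt_inv_sqrt_one_add_norm_sq hV
  simp only [tilt]
  rw [divergence_smul h.differentiableAt hV, h.fderiv]
  simp only [_root_.smul_apply, ContinuousLinearMap.comp_apply, innerSL_apply_apply, smul_eq_mul]
  ring

theorem contDiffAt_gradient [CompleteSpace E] {f : E → ℝ} {x : E} (hf : ContDiffAt ℝ 2 f x) :
    ContDiffAt ℝ 1 (gradient f) x :=
  (InnerProductSpace.toDual ℝ E).symm.contDiff.contDiffAt.comp x
    (hf.fderiv_right (by norm_num [one_add_one_eq_two]))

end Tilt

section GraphMap

variable {n : ℕ} {φ : EuclideanSpace ℝ (Fin n) → ℝ} {y : EuclideanSpace ℝ (Fin n)}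

theorem hasFDerivAt_graphMap (hφ : DifferentiableAt ℝ φ y) :
    HasFDerivAt (graphMap φ)
      (horizontal.toContinuousLinearMap + (fderiv ℝ φ y).smulRight eLast) y := by
  rw [graphMap_eq]
  exact horizontal.toContinuousLinearMap.hasFDerivAt.add (hφ.hasFDerivAt.smul_const eLast)

theorem partialDeriv_graphMap (hφ : DifferentiableAt ℝ φ y) (i : Fin n) :
    partialDeriv i (graphMap φ) y =
      horizontal (EuclideanSpace.single i 1) + gradient φ y i • eLast := by
  have h : gradient φ y i = fderiv ℝ φ y (EuclideanSpace.single i 1) := by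
    rw [← inner_gradient_left, EuclideanSpace.inner_single_right]
    simp
  rw [partialDeriv, (hasFDerivAt_graphMap hφ).fderiv, h]
  rfl

theorem injective_fderiv_graphMap (hφ : DifferentiableAt ℝ φ y) :
    Function.Injective (fderiv ℝ (graphMap φ) y) := by
  refine Function.LeftInverse.injective (g := base) fun v => ?_
  simp [(hasFDerivAt_graphMap hφ).fderiv]

theorem firstFundamentalForm_graphMap (hφ : DifferentiableAt ℝ φ y) :
    firstFundamentalForm (graphMap φ) y =
      1 + Matrix.vecMulVec (gradient φ y).ofLp (gradient φ y).ofLp := by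
  ext i j
  simp [firstFundamentalForm, partialDeriv_graphMap hφ, inner_eq_base_add_height,
    EuclideanSpace.inner_single_right, Matrix.vecMulVec_apply, Matrix.one_apply, PiLp.single_apply,
    eq_comm]

theorem jacobian_sq_eq_det_firstFundamentalForm
    (F : EuclideanSpace ℝ (Fin n) → EuclideanSpace ℝ (Fin (n + 1))) :
    jacobian F y ^ 2 = (firstFundamentalForm F y).det := by
  have h := (fderiv ℝ F y).toLinearMap.normDet_sq_eq_det_gram (EuclideanSpace.basisFun (Fin n) ℝ)
  simp only [EuclideanSpace.basisFun_apply] at h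
  exact h

theorem jacobian_graphMap (hφ : DifferentiableAt ℝ φ y) :
    jacobian (graphMap φ) y = √(1 + ‖gradient φ y‖ ^ 2) := by
  rw [eq_comm, Real.sqrt_eq_iff_eq_sq (by positivity) (jacobian_nonneg _ _),
    jacobian_sq_eq_det_firstFundamentalForm, firstFundamentalForm_graphMap hφ,
    Matrix.vecMulVec_eq Unit, Matrix.det_one_add_replicateCol_mul_replicateRow,
    EuclideanSpace.real_norm_sq_eq]
  simp [dotProduct, sq]

theorem graphMap_image (ω : Set (EuclideanSpace ℝ (Fin n))) (φ : EuclideanSpace ℝ (Fin n) → ℝ) :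
    graphMap φ '' ω = graph ω φ := by
  ext x
  refine ⟨?_, fun hx => ⟨base x, hx.1, ext_base_height (by simp) (by simpa using hx.2.symm)⟩⟩
  rintro ⟨y, hy, rfl⟩
  simpa [graph] using hy

theorem injective_graphMap (φ : EuclideanSpace ℝ (Fin n) → ℝ) : Function.Injective (graphMap φ) :=
  Function.LeftInverse.injective (base_graphMap φ)

theorem contDiffOn_graphMap {k : WithTop ℕ∞} {ω : Set (EuclideanSpace ℝ (Fin n))}
    (hφ : ContDiffOn ℝ k φ ω) : ContDiffOn ℝ k (graphMap φ) ω := by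
  rw [graphMap_eq]
  exact horizontal.contDiff.contDiffOn.add (hφ.smul contDiffOn_const)

theorem secondFundamentalForm_graphMap (hφ : ContDiffAt ℝ 2 φ y) (v : EuclideanSpace ℝ (Fin n)) :
    secondFundamentalForm (graphMap φ) (slopeNormal v) y = -(√(1 + ‖v‖ ^ 2))⁻¹ •
      (LinearMap.toMatrix (EuclideanSpace.basisFun (Fin n) ℝ).toBasis
        (EuclideanSpace.basisFun (Fin n) ℝ).toBasis (fderiv ℝ (gradient φ) y)).transpose := by
  have hgrad := ((contDiffAt_gradient hφ).differentiableAt one_ne_zero).hasFDerivAt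
  have hpartial (j : Fin n) : partialDeriv j (graphMap φ) =ᶠ[𝓝 y] fun x =>
      horizontal (EuclideanSpace.single j 1) + gradient φ x j • eLast := by
    filter_upwards [hφ.eventually (by simp)] with x hx
    exact partialDeriv_graphMap (hx.differentiableAt two_ne_zero) j
  have hpartial₂ (i j : Fin n) : partialDeriv i (partialDeriv j (graphMap φ)) y =
      fderiv ℝ (gradient φ) y (EuclideanSpace.single i 1) j • eLast := by
    have hj := ((EuclideanSpace.proj (𝕜 := ℝ) j).hasFDerivAt.comp y hgrad).smul_const
      (eLast (n := n)) |>.const_add (horizontal (EuclideanSpace.single j (1 : ℝ)))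
    rw [partialDeriv, (hpartial j).fderiv_eq]
    exact DFunLike.congr_fun hj.fderiv _
  ext i j
  simp [secondFundamentalForm, hpartial₂, slopeNormal, inner_eq_base_add_height,
    LinearMap.toMatrix_apply, mul_comm]

theorem inv_one_add_vecMulVec_self (v : EuclideanSpace ℝ (Fin n)) :
    (1 + Matrix.vecMulVec v.ofLp v.ofLp)⁻¹ =
      1 - (1 + ‖v‖ ^ 2)⁻¹ • Matrix.vecMulVec v.ofLp v.ofLp := by
  have hsq : Matrix.vecMulVec v.ofLp v.ofLp * Matrix.vecMulVec v.ofLp v.ofLp =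
      ‖v‖ ^ 2 • Matrix.vecMulVec v.ofLp v.ofLp := by
    rw [Matrix.vecMulVec_mul_vecMulVec, EuclideanSpace.real_norm_sq_eq, ← Matrix.smul_vecMulVec]
    simp [dotProduct, sq, Matrix.smul_vecMulVec]
  have hne : 1 + ‖v‖ ^ 2 ≠ 0 := by positivity
  refine Matrix.inv_eq_right_inv ?_
  rw [add_mul, one_mul, mul_sub, mul_one, mul_smul_comm, hsq]
  match_scalars <;> field_simp
  ring

theorem meanCurvature_graphMap (hφ : ContDiffAt ℝ 2 φ y) :
    meanCurvature (graphMap φ) (slopeNormal (gradient φ y)) y =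
      -(1 / (n : ℝ)) * divergence (fun x => tilt (gradient φ x)) y := by
  have hgrad := (contDiffAt_gradient hφ).differentiableAt one_ne_zero
  rw [meanCurvature, firstFundamentalForm_graphMap (hφ.differentiableAt two_ne_zero),
    secondFundamentalForm_graphMap hφ, divergence_tilt_comp hgrad, inv_one_add_vecMulVec_self]
  set v := gradient φ y
  set A := fderiv ℝ (gradient φ) y with hA
  set b := (EuclideanSpace.basisFun (Fin n) ℝ).toBasis
  have hinner : v.ofLp ⬝ᵥ (LinearMap.toMatrix b b A).mulVec v.ofLp = ⟪v, A v⟫ := by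
    have h : (LinearMap.toMatrix b b A).mulVec v.ofLp = (A v).ofLp :=
      LinearMap.toMatrix_mulVec_repr b b A v
    rw [h, EuclideanSpace.inner_eq_star_dotProduct, star_trivial, dotProduct_comm]
  rw [divergence, LinearMap.trace_eq_matrix_trace ℝ b, ← hA, ← hinner, Matrix.mul_smul,
    Matrix.trace_smul, Matrix.sub_mul, Matrix.one_mul, Matrix.smul_mul, Matrix.vecMulVec_mul,
    Matrix.trace_sub, Matrix.trace_smul, Matrix.trace_vecMulVec, Matrix.vecMul_transpose,
    Matrix.trace_transpose, smul_eq_mul, smul_eq_mul]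
  ring

end GraphMap

/-! ### Integration over the graph -/

section Extension

variable {E : Type*} [NormedAddCommGroup E] [InnerProductSpace ℝ E] [CompleteSpace E]
  {ω : Set E} {k : ℕ} {f : E → ℝ}

theorem ContDiffUpToBoundary.exists_gradient_extension (hf : ContDiffUpToBoundary k f ω)
    (hk : 1 ≤ k) : ∃ G : E → E, ContinuousOn G (closure ω) ∧ EqOn G (gradient f) ω := by
  obtain ⟨T, hT, hTf⟩ := hf.2.2 1 hk
  refine ⟨fun y => (InnerProductSpace.toDual ℝ E).symm
    (continuousMultilinearCurryFin1 ℝ E ℝ (T y)), ?_, fun y hy => ?_⟩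
  · exact (LinearIsometryEquiv.continuous _).comp_continuousOn
      ((LinearIsometryEquiv.continuous _).comp_continuousOn hT)
  · refine congrArg _ (ContinuousLinearMap.ext fun v => ?_)
    simp [hTf hy, iteratedFDeriv_one_apply]

theorem ContDiffUpToBoundary.exists_fderiv_gradient_extension (hf : ContDiffUpToBoundary k f ω)
    (hk : 2 ≤ k) :
    ∃ A : E → E →L[ℝ] E, ContinuousOn A (closure ω) ∧ EqOn A (fderiv ℝ (gradient f)) ω := by
  obtain ⟨T, hT, hTf⟩ := hf.2.2 2 hk
  let riesz : StrongDual ℝ E ≃L[ℝ] E := (InnerProductSpace.toDual ℝ E).symm.toContinuousLinearEquiv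
  let curry : (E [×1]→L[ℝ] ℝ) →L[ℝ] E :=
    riesz.toContinuousLinearMap ∘L
      (continuousMultilinearCurryFin1 ℝ E ℝ).toContinuousLinearEquiv.toContinuousLinearMap
  refine ⟨fun y => curry ∘L (T y).curryLeft, ?_, fun y hy => ?_⟩
  · exact continuousOn_const.clm_comp
      ((continuousMultilinearCurryLeftEquiv ℝ (fun _ => E) ℝ).continuous.comp_continuousOn hT)
  · have hgrad : fderiv ℝ (gradient f) y =
        riesz.toContinuousLinearMap ∘L fderiv ℝ (fderiv ℝ f) y := riesz.comp_fderiv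
    rw [hgrad]
    refine ContinuousLinearMap.ext fun v => congrArg riesz (ContinuousLinearMap.ext fun w => ?_)
    simp [hTf hy, iteratedFDeriv_two_apply]

end Extension

theorem integrableOn_of_continuousOn_closure {X F : Type*} [MetricSpace X] [ProperSpace X]
    [MeasurableSpace X] [OpensMeasurableSpace X] [NormedAddCommGroup F] {μ : Measure X}
    [IsFiniteMeasureOnCompacts μ] {s : Set X} (hs : Bornology.IsBounded s) {f : X → F}
    (hf : ContinuousOn f (closure s)) : IntegrableOn f s μ :=
  (hf.integrableOn_compact hs.isCompact_closure).mono_set subset_closure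

section Green

variable {E : Type*} [NormedAddCommGroup E] [InnerProductSpace ℝ E] [FiniteDimensional ℝ E]
  [MeasurableSpace E] [BorelSpace E] {μ : Measure E} {ω : Set E} {φ : E → ℝ}

theorem ContDiffUpToBoundary.integrableOn_norm_gradient_sq_div_sqrt [IsFiniteMeasureOnCompacts μ]
    {k : ℕ} (hφ : ContDiffUpToBoundary k φ ω) (hk : 1 ≤ k) (hω : IsOpen ω)
    (hωb : Bornology.IsBounded ω) :
    IntegrableOn (fun y => ‖gradient φ y‖ ^ 2 / √(1 + ‖gradient φ y‖ ^ 2)) ω μ := by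
  obtain ⟨G, hG, hGφ⟩ := hφ.exists_gradient_extension hk
  have hGt : ContinuousOn (fun y => ⟪G y, tilt (G y)⟫) (closure ω) :=
    hG.inner ((contDiff_tilt (k := 0)).continuous.comp_continuousOn hG)
  refine (integrableOn_of_continuousOn_closure hωb hGt).congr_fun (fun y hy => ?_)
    hω.measurableSet
  simp only [inner_tilt_right, hGφ hy]

theorem ContDiffUpToBoundary.integrableOn_mul_divergence_tilt_gradient
    [IsFiniteMeasureOnCompacts μ] (hφ : ContDiffUpToBoundary 2 φ ω) (hω : IsOpen ω)
    (hωb : Bornology.IsBounded ω) :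
    IntegrableOn (fun y => φ y * divergence (fun x => tilt (gradient φ x)) y) ω μ := by
  obtain ⟨G, hG, hGφ⟩ := hφ.exists_gradient_extension one_le_two
  obtain ⟨A, hA, hAφ⟩ := hφ.exists_fderiv_gradient_extension le_rfl
  have htilt : Continuous (fderiv ℝ (tilt : E → E)) :=
    (contDiff_tilt (k := 1)).continuous_fderiv one_ne_zero
  have hdiv : ContinuousOn
      (fun y => LinearMap.trace ℝ E (fderiv ℝ tilt (G y) ∘L A y : E →L[ℝ] E)) (closure ω) :=
    continuous_trace.comp_continuousOn ((htilt.comp_continuousOn hG).clm_comp hA)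
  refine (integrableOn_of_continuousOn_closure hωb (hφ.2.1.mul hdiv)).congr_fun
    (fun y hy => ?_) hω.measurableSet
  have hgrad : DifferentiableAt ℝ (gradient φ) y :=
    (contDiffAt_gradient (hφ.1.contDiffAt (hω.mem_nhds hy))).differentiableAt one_ne_zero
  have hcomp : fderiv ℝ (fun x => tilt (gradient φ x)) y = fderiv ℝ tilt (G y) ∘L A y := by
    rw [hGφ hy, hAφ hy]
    exact fderiv_fun_comp y ((contDiff_tilt (k := 1)).differentiable one_ne_zero _) hgrad
  simp only [divergence, hcomp, Pi.mul_apply]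

theorem setIntegral_mul_divergence_tilt_gradient_eq_neg [μ.IsAddHaarMeasure]
    (hφ : ContDiffUpToBoundary 2 φ ω) (hω : IsOpen ω) (hωb : Bornology.IsBounded ω) {G : E → E}
    (hG : ContinuousOn G (closure ω)) (hGφ : EqOn G (gradient φ) ω)
    (htan : ∀ p ∈ frontier ω, IsTangentialNear ω G p) :
    ∫ y in ω, φ y * divergence (fun x => tilt (gradient φ x)) y ∂μ =
      -∫ y in ω, ‖gradient φ y‖ ^ 2 / √(1 + ‖gradient φ y‖ ^ 2) ∂μ := by
  have hφ1 : ContDiffOn ℝ 1 φ ω := hφ.1.of_le one_le_two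
  have htiltG : EqOn (fun y => tilt (G y)) (fun y => tilt (gradient φ y)) ω :=
    fun y hy => congrArg tilt (hGφ hy)
  have hV : ContDiffOn ℝ 1 (fun y => tilt (G y)) ω :=
    ContDiffOn.congr (fun y hy => (contDiff_tilt.contDiffAt.comp y
      (contDiffAt_gradient (hφ.1.contDiffAt (hω.mem_nhds hy)))).contDiffWithinAt) htiltG
  have hdiv : EqOn (fun y => φ y * divergence (fun x => tilt (G x)) y)
      (fun y => φ y * divergence (fun x => tilt (gradient φ x)) y) ω := fun y hy =>
    congrArg (φ y * ·) (divergence_congr (htiltG.eventuallyEq_of_mem (hω.mem_nhds hy)))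
  have hderiv : EqOn (fun y => fderiv ℝ φ y (tilt (G y)))
      (fun y => ‖gradient φ y‖ ^ 2 / √(1 + ‖gradient φ y‖ ^ 2)) ω := fun y hy => by
    simp only
    rw [hGφ hy, ← inner_gradient_left, inner_tilt_right]
  rw [← setIntegral_congr_fun hω.measurableSet hdiv,
    ← setIntegral_congr_fun hω.measurableSet hderiv]
  exact setIntegral_mul_divergence_eq_neg hω hωb hφ.2.1 hφ1
    ((contDiff_tilt (k := 0)).continuous.comp_continuousOn hG) hV
    ((hφ.integrableOn_mul_divergence_tilt_gradient hω hωb).congr_fun hdiv.symm hω.measurableSet)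
    ((hφ.integrableOn_norm_gradient_sq_div_sqrt one_le_two hω hωb).congr_fun hderiv.symm
      hω.measurableSet)
    fun p hp => (htan p hp).smul _

end Green

section PullBack

variable {n : ℕ} {ω : Set (EuclideanSpace ℝ (Fin n))} {φ : EuclideanSpace ℝ (Fin n) → ℝ}

theorem eqOn_jacobian_graphMap_smul (hω : IsOpen ω) (hφ : ContDiffOn ℝ 1 φ ω)
    (g : EuclideanSpace ℝ (Fin (n + 1)) → ℝ) :
    EqOn (fun y => jacobian (graphMap φ) y • g (graphMap φ y))
      (fun y => √(1 + ‖gradient φ y‖ ^ 2) * g (graphMap φ y)) ω := fun y hy => by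
  simp only [smul_eq_mul]
  rw [jacobian_graphMap ((hφ.contDiffAt (hω.mem_nhds hy)).differentiableAt one_ne_zero)]

theorem integrableOn_graph_iff (hω : IsOpen ω) (hφ : ContDiffOn ℝ 1 φ ω)
    (g : EuclideanSpace ℝ (Fin (n + 1)) → ℝ) :
    IntegrableOn g (graph ω φ) μHE[n] ↔
      IntegrableOn (fun y => √(1 + ‖gradient φ y‖ ^ 2) * g (graphMap φ y)) ω := by
  have h := integrableOn_image_iff_integrableOn_jacobian_smul hω (contDiffOn_graphMap hφ)
    (fun y hy => injective_fderiv_graphMap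
      ((hφ.contDiffAt (hω.mem_nhds hy)).differentiableAt one_ne_zero))
    (injective_graphMap φ).injOn g
  rw [finrank_euclideanSpace_fin, graphMap_image] at h
  exact h.trans (integrableOn_congr_fun (eqOn_jacobian_graphMap_smul hω hφ g) hω.measurableSet)

theorem setIntegral_graph_eq (hω : IsOpen ω) (hφ : ContDiffOn ℝ 1 φ ω)
    (g : EuclideanSpace ℝ (Fin (n + 1)) → ℝ) :
    ∫ x in graph ω φ, g x ∂μHE[n] = ∫ y in ω, √(1 + ‖gradient φ y‖ ^ 2) * g (graphMap φ y) := by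
  have h := setIntegral_image_eq_setIntegral_jacobian_smul hω (contDiffOn_graphMap hφ)
    (fun y hy => injective_fderiv_graphMap
      ((hφ.contDiffAt (hω.mem_nhds hy)).differentiableAt one_ne_zero))
    (injective_graphMap φ).injOn g
  rw [finrank_euclideanSpace_fin, graphMap_image] at h
  exact h.trans (setIntegral_congr_fun hω.measurableSet (eqOn_jacobian_graphMap_smul hω hφ g))

theorem sqrt_mul_graphMeanCurvature_mul_inner (hω : IsOpen ω) (hφ : ContDiffOn ℝ 2 φ ω)
    (hpos : ∀ y ∈ ω, 0 < φ y) {G : EuclideanSpace ℝ (Fin n) → EuclideanSpace ℝ (Fin n)}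
    (hG : ContinuousOn G (closure ω)) (hGφ : EqOn G (gradient φ) ω) :
    EqOn (fun y => √(1 + ‖gradient φ y‖ ^ 2) * (graphMeanCurvature ω φ (graphMap φ y) *
        ⟪height (graphMap φ y) • eLast, graphNormal ω φ (graphMap φ y)⟫))
      (fun y => -(1 / (n : ℝ)) * (φ y * divergence (fun x => tilt (gradient φ x)) y)) ω := by
  intro y hy
  have hnormal : graphNormal ω φ (graphMap φ y) = slopeNormal (gradient φ y) := by
    rw [graphNormal_eq_slopeNormal hω (hφ.of_le one_le_two) hpos hG hGφ
      (subset_closure (graphMap_image ω φ ▸ mem_image_of_mem _ hy)), base_graphMap, hGφ hy]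
  have hinner : ⟪φ y • eLast, slopeNormal (gradient φ y)⟫ =
      (√(1 + ‖gradient φ y‖ ^ 2))⁻¹ * φ y := by
    simp [slopeNormal, inner_eq_base_add_height, mul_comm]
  have hW : √(1 + ‖gradient φ y‖ ^ 2) ≠ 0 := by positivity
  simp only [graphMeanCurvature, hnormal, base_graphMap, height_graphMap, hinner,
    meanCurvature_graphMap (hφ.contDiffAt (hω.mem_nhds hy))]
  field_simp

end PullBack

end CylinderGraph

end

open CylinderGraph in
theorem proposition2p2_general (n : ℕ) (_hn : 1 ≤ n)
    (ω : Set (EuclideanSpace ℝ (Fin n))) (hω : IsOpen ω) (hωb : Bornology.IsBounded ω)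
    (hω' : ∀ p ∈ frontier ω, ∃ g, IsLocalDefiningFunction 1 ω p g)
    (φ : EuclideanSpace ℝ (Fin n) → ℝ) (hφ : ContDiffUpToBoundary 2 φ ω)
    (hpos : ∀ y ∈ closure ω, 0 < φ y) (horth : MeetsOrthogonally ω φ) :
    IntegrableOn (fun x => graphMeanCurvature ω φ x * ⟪height x • eLast, graphNormal ω φ x⟫)
      (graph ω φ) μHE[n] ∧
    IntegrableOn (fun y => ‖gradient φ y‖ ^ 2 / √(1 + ‖gradient φ y‖ ^ 2)) ω volume ∧
    ∫ x in graph ω φ,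
        graphMeanCurvature ω φ x * ⟪height x • eLast, graphNormal ω φ x⟫ ∂μHE[n] =
      (1 / (n : ℝ)) * ∫ y in ω, ‖gradient φ y‖ ^ 2 / √(1 + ‖gradient φ y‖ ^ 2) := by
  have hφ1 : ContDiffOn ℝ 1 φ ω := hφ.1.of_le one_le_two
  obtain ⟨G, hG, hGφ⟩ := hφ.exists_gradient_extension one_le_two
  have htan : ∀ p ∈ frontier ω, IsTangentialNear ω G p := fun p hp =>
    let ⟨_, hg⟩ := hω' p hp
    isTangentialNear_of_inner_gradient_eq_zero hω hg fun _ hx hgx =>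
      horth.inner_gradient_eq_zero hω hφ1 hφ.2.1 hpos hG hGφ hx hgx
  have hpull := sqrt_mul_graphMeanCurvature_mul_inner hω hφ.1
    (fun y hy => hpos y (subset_closure hy)) hG hGφ
  refine ⟨?_, hφ.integrableOn_norm_gradient_sq_div_sqrt one_le_two hω hωb, ?_⟩
  · rw [integrableOn_graph_iff hω hφ1, integrableOn_congr_fun hpull hω.measurableSet]
    exact (hφ.integrableOn_mul_divergence_tilt_gradient hω hωb).const_mul _
  · rw [setIntegral_graph_eq hω hφ1, setIntegral_congr_fun hω.measurableSet hpull,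
      integral_const_mul,
      setIntegral_mul_divergence_tilt_gradient_eq_neg hφ hω hωb hG hGφ htan, neg_mul_neg]

theorem proposition2p2 (n : ℕ) (hn : 1 ≤ n)
    (ω : Set (EuclideanSpace ℝ (Fin n))) (hω : CylinderGraph.IsSmoothBoundedDomain ω)
    (φ : EuclideanSpace ℝ (Fin n) → ℝ) (hφ : CylinderGraph.ContDiffUpToBoundary 2 φ ω)
    (hpos : ∀ y ∈ closure ω, 0 < φ y)
    (horth : CylinderGraph.MeetsOrthogonally ω φ) :
    IntegrableOn
      (fun x => CylinderGraph.graphMeanCurvature ω φ x *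
        ⟪CylinderGraph.height x • CylinderGraph.eLast, CylinderGraph.graphNormal ω φ x⟫)
      (CylinderGraph.graph ω φ) μHE[n] ∧
    IntegrableOn (fun y => ‖gradient φ y‖ ^ 2 / Real.sqrt (1 + ‖gradient φ y‖ ^ 2)) ω volume ∧
    ∫ x in CylinderGraph.graph ω φ, CylinderGraph.graphMeanCurvature ω φ x *
        ⟪CylinderGraph.height x • CylinderGraph.eLast, CylinderGraph.graphNormal ω φ x⟫ ∂μHE[n] =
      (1 / (n : ℝ)) *
        ∫ y in ω, ‖gradient φ y‖ ^ 2 / Real.sqrt (1 + ‖gradient φ y‖ ^ 2) :=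
  proposition2p2_general n hn ω hω.isOpen hω.isBounded
    (fun p hp => (hω.smooth_boundary p hp).imp fun _ hg => hg.of_le le_top) φ hφ hpos horth
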